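/- Let $G=(V,E)$ be a finite simple undirected graph. A function $f\colon V\to\{0,1,2\}$ is a Roman dominating function (rdf) of $G$ if every $v\in V$ with $f(v)=0$ has a neighbour $u$ with $f(u)=2$; it is a minimal rdf if no rdf $g\neq f$ satisfies $g(v)\le f(v)$ for all $v\in V$. The graph $G$ is an interval graph if there are closed intervals $I_v=[l_v,r_v]\subseteq\mathbb{R}$, $l_v\le r_v$ $(v\in V)$, such that two distinct vertices $u,v$ are adjacent if and only if $I_u\cap I_v\neq\emptyset$. Theorem. There is one algorithm that, given the adjacency matrix of any interval graph $G$ of order $n$, outputs every minimal rdf of $G$ exactly once, and nothing else, and then halts, such that, for suitable polynomials $p,d,s$ that do not depend on $n$ or $G$: 1. (time) it halts after at most $p(n)\cdot\sqrt{3}^{\,n}$ steps, i.e. its running time is $\mathcal{O}^*(\sqrt{3}^{\,n})$; 2. (polynomial delay) at most $d(n)$ steps pass before the first output, between any two consecutive outputs, and between the last output and the halt; 3. (polynomial space) it uses at most $s(n)$ bits of working memory at any time. In particular, there is a polynomial $q$ such that every interval graph of order $n$ has at most $q(n)\cdot\sqrt{3}^{\,n}$ minimal rdf. This is tight: for every $k\ge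 0$ the disjoint union of $k$ copies of the path $P_2$ is an interval graph of order $n=2k$ with exactly $3^k=\sqrt{3}^{\,n}$ minimal rdf. Here an algorithm is a program of a random access machine with read-only input, write-only output, and unit-cost instructions: loading a constant, addition, truncated subtraction, reading an input symbol, indirect load and store, jumps, and output. The working memory in use is measured as the total binary length of the addresses and contents of all nonzero registers. -/

import Mathlib

/-! ### Roman domination, interval graphs -/

/-- `f : V → {0,1,2}` is a Roman dominating function of `G`: every vertex of value `0` has a
neighbour of value `2`. -/
def IsRomanDominating {V : Type*} (G : SimpleGraph V) (f : V → Fin 3) : Prop :=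
  ∀ v, f v = 0 → ∃ u, G.Adj v u ∧ f u = 2

/-- Minimal Roman dominating functions, with respect to the pointwise order on `V → {0,1,2}`. -/
def IsMinimalRdf {V : Type*} (G : SimpleGraph V) (f : V → Fin 3) : Prop :=
  Minimal (IsRomanDominating G) f

/-- `G` is an interval graph: the intersection graph of a family of nonempty closed
intervals `[l v, r v]` of the real line. -/
def IsIntervalGraph {V : Type*} (G : SimpleGraph V) : Prop :=
  ∃ l r : V → ℝ, (∀ v, l v ≤ r v) ∧
    ∀ u v, G.Adj u v ↔ u ≠ v ∧ (Set.Icc (l u) (r u) ∩ Set.Icc (l v) (r v)).Nonempty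

/-- The disjoint union of `k` copies of the path `P₂` on two vertices. -/
def disjointUnionP2 (k : ℕ) : SimpleGraph (Fin k × Fin 2) where
  Adj x y := x.1 = y.1 ∧ (SimpleGraph.pathGraph 2).Adj x.2 y.2
  symm := ⟨fun _ _ h => ⟨h.1.symm, h.2.symm⟩⟩
  loopless := ⟨fun _ h => h.2.ne rfl⟩

/-! ### Random access machines

A machine has a read-only input word, registers `0, 1, 2, …` holding natural numbers (all zero at
the start) with indirect addressing, and a write-only output. Every instruction costs one step.
Multiplication is not an instruction, so that one step lengthens the stored numbers by at most
a constant number of bits, apart from symbols copied from the input. -/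

namespace RAM

/-- Instructions; `d`, `a`, `b` are register addresses, `k` a constant, `l` a program line. -/
inductive Instr where
  /-- `R[d] := k` -/
  | imm (d k : ℕ)
  /-- `R[d] := R[a] + R[b]` -/
  | add (d a b : ℕ)
  /-- `R[d] := R[a] - R[b]`, or `0` if this is negative -/
  | sub (d a b : ℕ)
  /-- `R[d] :=` the input symbol at position `R[a]` (positions count from `0`), or `0` if the input
  word is not that long -/
  | read (d a : ℕ)
  /-- `R[d] := R[R[a]]` -/
  | load (d a : ℕ)
  /-- `R[R[d]] := R[a]` -/
  | store (d a : ℕ)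
  /-- go to line `l` -/
  | jump (l : ℕ)
  /-- go to line `l` if `R[a] = 0` -/
  | jzero (a l : ℕ)
  /-- append the symbol `R[a]` to the word that is being printed -/
  | print (a : ℕ)
  /-- the word that is being printed is complete: deliver it, and begin a new, empty one -/
  | emit

/-- A program is a finite list of instructions, with lines numbered from `0`. -/
abbrev Program := List Instr

/-- Configurations: the program line, the registers, the word being printed, and the list of words
delivered so far, in the order of their delivery. -/
structure Cfg where
  pc : ℕ
  mem : ℕ →₀ ℕ
  word : List ℕ
  outs : List (List ℕ)

/-- Write the value `x` into register `d` and go on to the next line. -/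
noncomputable def Cfg.write (c : Cfg) (d x : ℕ) : Cfg :=
  { c with pc := c.pc + 1, mem := c.mem.update d x }

/-- The effect of one instruction; `x` is the input word. -/
noncomputable def Instr.exec (x : List ℕ) (c : Cfg) : Instr → Cfg
  | .imm d k => c.write d k
  | .add d a b => c.write d (c.mem a + c.mem b)
  | .sub d a b => c.write d (c.mem a - c.mem b)
  | .read d a => c.write d (x.getD (c.mem a) 0)
  | .load d a => c.write d (c.mem (c.mem a))
  | .store d a => c.write (c.mem d) (c.mem a)
  | .jump l => { c with pc := l }
  | .jzero a l => { c with pc := if c.mem a = 0 then l else c.pc + 1 }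
  | .print a => { c with pc := c.pc + 1, word := c.word ++ [c.mem a] }
  | .emit => { c with pc := c.pc + 1, word := [], outs := c.outs ++ [c.word] }

/-- One step. The machine has halted when the program has no line `pc`; then nothing changes. -/
noncomputable def step (P : Program) (x : List ℕ) (c : Cfg) : Cfg :=
  match P[c.pc]? with
  | some i => i.exec x c
  | none => c

/-- The configuration after `t` steps on the input word `x`. -/
noncomputable def run (P : Program) (x : List ℕ) (t : ℕ) : Cfg :=
  (step P x)^[t] ⟨0, 0, [], []⟩

/-- On the input `x`, the program has halted after at most `t` steps. -/
def HaltedBy (P : Program) (x : List ℕ) (t : ℕ) : Prop :=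
  P.length ≤ (run P x t).pc

/-- The number of bits needed to write down the memory: every register that is not zero is charged
the binary length of its address plus the binary length of its content. -/
def memSize (m : ℕ →₀ ℕ) : ℕ :=
  m.sum fun a v => Nat.size a + Nat.size v

/-- On the input `x`, the program halts after at most `T` steps, and the words that it has delivered
are exactly the members of `S`, each of them delivered once. -/
def EnumeratesInTime (P : Program) (x : List ℕ) (S : Set (List ℕ)) (T : ℕ) : Prop :=
  HaltedBy P x T ∧ (run P x T).outs.Nodup ∧ ∀ w, w ∈ (run P x T).outs ↔ w ∈ S

/-- On the input `x`, the program has delay at most `d`: from any time `t` on, it takes at most `d`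
steps until a further word is delivered or the program has halted. So there are at most `d` steps
before the first delivery, between two consecutive ones, and from the last one to the halt. -/
def DelayAtMost (P : Program) (x : List ℕ) (d : ℕ) : Prop :=
  ∀ t, (run P x t).outs.length < (run P x (t + d)).outs.length ∨ HaltedBy P x (t + d)

/-- On the input `x`, the program never uses more than `s` bits of memory. -/
def SpaceAtMost (P : Program) (x : List ℕ) (s : ℕ) : Prop :=
  ∀ t, memSize (run P x t).mem ≤ s

end RAM

/-! ### Encodings -/

open Classical in
/-- A graph with vertices `0, …, n - 1` as an input word: the number `n`, followed by the rows of
the adjacency matrix, so that the entry `(i, j)` is at position `1 + (i * n + j)`. -/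
noncomputable def encodeGraph {n : ℕ} (G : SimpleGraph (Fin n)) : List ℕ :=
  n :: List.ofFn fun k : Fin (n * n) => if G.Adj k.divNat k.modNat then 1 else 0

/-- A function `f : {0, …, n - 1} → {0,1,2}` as the output word `f 0, …, f (n - 1)`. -/
def encodeFun {n : ℕ} (f : Fin n → Fin 3) : List ℕ :=
  List.ofFn fun i => (f i : ℕ)

/-! A minimal Roman dominating function is determined by its set `A` of vertices of value 2. The
sets that occur are the open irredundant ones, in which every member has a private neighbour outside
`A`; the function is then 0 on the other vertices dominated by `A` and 1 elsewhere
(`isMinimalRdf_rdfOfSet`, `IsMinimalRdf.isOpenIrredundant`, `IsMinimalRdf.eq_rdfOfSet`). So open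
irredundant sets have to be enumerated and counted.

Enumeration: open irredundance passes to subsets. A depth-first search that adds vertices in
increasing order and prunes as soon as the property fails therefore keeps only sets that are
delivered. The current set and one pointer are its whole state. Every round delivers a word or
lowers the pointer, so delay and space are polynomial, and the total time is a polynomial times the
number of outputs (`exists_haltedBy`, `delayAtMost_enumProgram`, `spaceAtMost_enumProgram`).

Counting: sort the vertices by left endpoint and let `v` end first among those from `p` on. The
vertices in `[p, R v)` form a clique, which contains at most one member of `A` if private neighbours
are sought from `p` on. Branching on this member pushes the rest of `A` beyond the clique. With `T`
counting `irrSets n R p p`, `D` counting `almostIrrSets n R p` and `N` vertices left, induction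
gives `T ≤ √3 ^ N` and `D ≤ (1 + √3) / 2 * √3 ^ N` (`card_irrSets_le_and`). A clique of two vertices
with equal right endpoints gives the factor 3 for two vertices, as in a union of copies of `P₂`. -/

/-! ### Counting open irredundant sets in a combinatorial model of interval graphs -/

namespace IntervalModel

/-- Vertices are natural numbers in the order of their left endpoints; `R i` is the number of
left endpoints that are at most the right endpoint of `i`. -/
def Meets (R : ℕ → ℕ) (i j : ℕ) : Prop := i < R j ∧ j < R i

/-- `b` is an external private neighbour of `a` with respect to `A`. -/
def IsPriv (R : ℕ → ℕ) (A : Finset ℕ) (a b : ℕ) : Prop :=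
  b ≠ a ∧ Meets R a b ∧ ∀ a' ∈ A, a' ≠ a → ¬ Meets R a' b

theorem IsPriv.mono {R : ℕ → ℕ} {A B : Finset ℕ} {a b : ℕ} (h : IsPriv R B a b) (hAB : A ⊆ B) :
    IsPriv R A a b :=
  ⟨h.1, h.2.1, fun a' ha' => h.2.2 a' (hAB ha')⟩

open Classical in
/-- Sets of vertices from `p` on, all of whose members have private neighbours from `q` on. -/
noncomputable def irrSets (n : ℕ) (R : ℕ → ℕ) (p q : ℕ) : Finset (Finset ℕ) :=
  (Finset.Ico p n).powerset.filter fun A => ∀ a ∈ A, ∃ b, q ≤ b ∧ b < n ∧ IsPriv R A a b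

open Classical in
/-- Sets of vertices from `p` on, all of whose members but the first have private neighbours. -/
noncomputable def almostIrrSets (n : ℕ) (R : ℕ → ℕ) (p : ℕ) : Finset (Finset ℕ) :=
  (Finset.Ico p n).powerset.filter fun A =>
    ∀ a ∈ A, (∃ a' ∈ A, a' < a) → ∃ b < n, IsPriv R A a b

variable {n : ℕ} {R : ℕ → ℕ} {p q : ℕ}

theorem mem_irrSets {A : Finset ℕ} : A ∈ irrSets n R p q ↔
    (∀ a ∈ A, p ≤ a ∧ a < n) ∧ ∀ a ∈ A, ∃ b, q ≤ b ∧ b < n ∧ IsPriv R A a b := by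
  simp [irrSets, Finset.subset_iff]

theorem mem_almostIrrSets {A : Finset ℕ} : A ∈ almostIrrSets n R p ↔
    (∀ a ∈ A, p ≤ a ∧ a < n) ∧
      ∀ a ∈ A, (∃ a' ∈ A, a' < a) → ∃ b < n, IsPriv R A a b := by
  simp [almostIrrSets, Finset.subset_iff]

theorem irrSets_mono {p' q' : ℕ} (hp : p' ≤ p) (hq : q' ≤ q) :
    irrSets n R p q ⊆ irrSets n R p' q' := by
  intro A hA
  rw [mem_irrSets] at hA ⊢
  refine ⟨fun a ha => ⟨hp.trans (hA.1 a ha).1, (hA.1 a ha).2⟩, fun a ha => ?_⟩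
  obtain ⟨b, h1, h2⟩ := hA.2 a ha
  exact ⟨b, hq.trans h1, h2⟩

theorem irrSets_subset_almostIrrSets : irrSets n R p q ⊆ almostIrrSets n R p := by
  intro A hA
  rw [mem_irrSets] at hA
  rw [mem_almostIrrSets]
  refine ⟨hA.1, fun a ha _ => ?_⟩
  obtain ⟨b, -, h2⟩ := hA.2 a ha
  exact ⟨b, h2⟩

theorem almostIrrSets_mono {p' : ℕ} (hp : p' ≤ p) :
    almostIrrSets n R p ⊆ almostIrrSets n R p' := by
  intro A hA
  rw [mem_almostIrrSets] at hA ⊢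
  exact ⟨fun a ha => ⟨hp.trans (hA.1 a ha).1, (hA.1 a ha).2⟩, hA.2⟩

theorem irrSets_of_le (h : n ≤ q) : irrSets n R p q ⊆ {∅} := by
  intro A hA
  rw [mem_irrSets] at hA
  rw [Finset.mem_singleton, Finset.eq_empty_iff_forall_notMem]
  intro a ha
  obtain ⟨b, h1, h2, -⟩ := hA.2 a ha
  omega

theorem almostIrrSets_of_le (h : n ≤ p) : almostIrrSets n R p ⊆ {∅} := by
  intro A hA
  rw [mem_almostIrrSets] at hA
  rw [Finset.mem_singleton, Finset.eq_empty_iff_forall_notMem]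
  intro a ha
  have := hA.1 a ha
  omega

/-! ### Branching on a single vertex -/

theorem card_le_of_erase_mem {S S₀ S₁ : Finset (Finset ℕ)} {a : ℕ}
    (h : ∀ A ∈ S, A ∈ S₀ ∨ a ∈ A ∧ A.erase a ∈ S₁) : S.card ≤ S₀.card + S₁.card := by
  have : S ⊆ S₀ ∪ S₁.image (fun B => insert a B) := by
    intro A hA
    rw [Finset.mem_union, Finset.mem_image]
    exact (h A hA).imp id fun h' => ⟨A.erase a, h'.2, Finset.insert_erase h'.1⟩
  refine le_trans (Finset.card_le_card this) (le_trans (Finset.card_union_le _ _) ?_)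
  exact Nat.add_le_add_left Finset.card_image_le _

/-- If `p` is a member, it is the exempt first one. A private neighbour `b ≤ p` of a later member
would reach past `p` and so meet `p`; hence the other members have their private neighbours after
`p`. -/
theorem card_almostIrrSets_le (hR : ∀ i < n, i < R i) :
    (almostIrrSets n R p).card ≤
      (almostIrrSets n R (p + 1)).card + (irrSets n R (p + 1) (p + 1)).card := by
  apply card_le_of_erase_mem (a := p)
  intro A hA
  rw [mem_almostIrrSets] at hA
  by_cases hp : p ∈ A
  · refine Or.inr ⟨hp, ?_⟩
    rw [mem_irrSets]
    refine ⟨fun a ha => ?_, fun a ha => ?_⟩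
    · rw [Finset.mem_erase] at ha
      have := hA.1 a ha.2
      omega
    · rw [Finset.mem_erase] at ha
      have hpa := hA.1 a ha.2
      obtain ⟨b, hb, hab⟩ := hA.2 a ha.2 ⟨p, hp, by omega⟩
      refine ⟨b, ?_, hb, hab.mono (Finset.erase_subset _ _)⟩
      have h1 := hab.2.1
      have h2 := hab.2.2 p hp (by omega)
      unfold Meets at h1 h2
      have h3 := hR p (hA.1 p hp).2
      omega
  · refine Or.inl ?_
    rw [mem_almostIrrSets]
    refine ⟨fun a ha => ?_, hA.2⟩
    have := hA.1 a ha
    have : a ≠ p := fun h => hp (h ▸ ha)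
    omega

/-- Here `p` meets no later vertex, so it can neither have a private neighbour from `p` on nor be
one for a later member. -/
theorem irrSets_subset_succ (hv : R p = p + 1) :
    irrSets n R p p ⊆ irrSets n R (p + 1) (p + 1) := by
  intro A hA
  rw [mem_irrSets] at hA ⊢
  have hp : p ∉ A := by
    intro hp
    obtain ⟨b, h1, h2, h3, h4, -⟩ := hA.2 p hp
    unfold Meets at h4
    omega
  have hA1 : ∀ a ∈ A, p + 1 ≤ a ∧ a < n := fun a ha => by
    have := hA.1 a ha
    have : a ≠ p := fun h => hp (h ▸ ha)
    omega
  refine ⟨hA1, fun a ha => ?_⟩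
  obtain ⟨b, h1, h2, h3⟩ := hA.2 a ha
  refine ⟨b, ?_, h2, h3⟩
  have := hA1 a ha
  have h4 := h3.2.1
  unfold Meets at h4
  rcases h1.eq_or_lt with rfl | h
  · omega
  · exact h

/-- A vertex with minimal right endpoint among the vertices from `p` on. -/
structure IsFirst (n : ℕ) (R : ℕ → ℕ) (p v : ℕ) : Prop where
  le : p ≤ v
  lt : v < n
  min : ∀ i, p ≤ i → i < n → R v ≤ R i

theorem exists_isFirst (hp : p < n) : ∃ v, IsFirst n R p v := by
  obtain ⟨v, hv, h⟩ := Finset.exists_min_image (Finset.Ico p n) R ⟨p, by simp [hp]⟩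
  rw [Finset.mem_Ico] at hv
  exact ⟨v, hv.1, hv.2, fun i h1 h2 => h i (by simp [h1, h2])⟩

/-- Let `p` be a member with private neighbour `b`. The private neighbour `c` of another member `a`
misses `p`, so it starts after `p` ends, and `b < R p ≤ c`. As `a` reaches `c` but misses `b`, it
starts after `b` ends, at `R b ≥ R v` or later. -/
theorem card_irrSets_succ_le {v : ℕ} (hR : ∀ i < n, i < R i) (hv : IsFirst n R (p + 1) v) :
    (irrSets n R p (p + 1)).card ≤
      (irrSets n R (p + 1) (p + 1)).card + (almostIrrSets n R (R v)).card := by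
  apply card_le_of_erase_mem (a := p)
  intro A hA
  rw [mem_irrSets] at hA
  by_cases hp : p ∈ A
  · refine Or.inr ⟨hp, irrSets_subset_almostIrrSets (q := 0) ?_⟩
    obtain ⟨b, hb1, hb2, hb⟩ := hA.2 p hp
    rw [mem_irrSets]
    refine ⟨fun a ha => ?_, fun a ha => ?_⟩
    · rw [Finset.mem_erase] at ha
      refine ⟨?_, (hA.1 a ha.2).2⟩
      have h1 := hb.2.2 a ha.2 ha.1
      have h2 := hb.2.1
      have h3 := hv.min b hb1 hb2
      obtain ⟨c, hc1, hc2, hc⟩ := hA.2 a ha.2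
      have h4 := hc.2.1
      have h5 := hc.2.2 p hp ha.1.symm
      have h6 := hR c hc2
      unfold Meets at h1 h2 h4 h5
      omega
    · rw [Finset.mem_erase] at ha
      obtain ⟨b, -, h2, h3⟩ := hA.2 a ha.2
      exact ⟨b, Nat.zero_le _, h2, h3.mono (Finset.erase_subset _ _)⟩
  · refine Or.inl ?_
    rw [mem_irrSets]
    refine ⟨fun a ha => ?_, hA.2⟩
    have := hA.1 a ha
    have : a ≠ p := fun h => hp (h ▸ ha)
    omega

/-! ### Branching on the clique of the vertex that ends first -/

/-- The members of an irredundant set that meet the first vertex: there is at most one. -/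
theorem le_of_mem_irrSets {v a a' : ℕ} {A : Finset ℕ}
    (hv : IsFirst n R p v) (hA : A ∈ irrSets n R p p) (ha : a ∈ A) (hav : a < R v)
    (ha' : a' ∈ A) (hne : a' ≠ a) : R v ≤ a' := by
  rw [mem_irrSets] at hA
  obtain ⟨b, hb1, hb2, hb⟩ := hA.2 a ha
  obtain ⟨c, hc1, hc2, hc⟩ := hA.2 a' ha'
  -- If both members start before `R v`, then `b` and `c`, which end no earlier than `v`, meet a
  -- member as soon as they start before its right end. The member that ends later would then meet
  -- both private neighbours.
  have h1 := hb.2.1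
  have h2 := hb.2.2 a' ha' hne
  have h3 := hc.2.1
  have h4 := hc.2.2 a ha hne.symm
  have h5 := hv.min b hb1 hb2
  have h6 := hv.min c hc1 hc2
  unfold Meets at h1 h2 h3 h4
  omega

theorem erase_mem_irrSets {v a : ℕ} {A : Finset ℕ}
    (hv : IsFirst n R p v) (hA : A ∈ irrSets n R p p) (ha : a ∈ A) (hav : a < R v) :
    A.erase a ∈ irrSets n R (R v) (R a) := by
  have key := fun a' => le_of_mem_irrSets (a' := a') hv hA ha hav
  rw [mem_irrSets] at hA ⊢
  refine ⟨fun a' ha' => ?_, fun a' ha' => ?_⟩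
  · rw [Finset.mem_erase] at ha'
    exact ⟨key a' ha'.2 ha'.1, (hA.1 a' ha'.2).2⟩
  · rw [Finset.mem_erase] at ha'
    obtain ⟨c, hc1, hc2, hc⟩ := hA.2 a' ha'.2
    refine ⟨c, ?_, hc2, hc.mono (Finset.erase_subset _ _)⟩
    -- As `c` ends no earlier than `v`, it ends after the start of `a`; to miss `a` it must start at
    -- `R a` or later.
    have h4 := hc.2.2 a ha ha'.1.symm
    have h6 := hv.min c hc1 hc2
    unfold Meets at h4
    omega

/-- If the first vertex is a member, then its private neighbour bounds the other members. -/
theorem erase_first_mem_irrSets {v m : ℕ} {A : Finset ℕ} (hR : ∀ i < n, i < R i)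
    (hv : IsFirst n R p v) (hA : A ∈ irrSets n R p p) (hvA : v ∈ A)
    (hm : ∀ b, p ≤ b → b < R v → b ≠ v → m ≤ R b) :
    A.erase v ∈ irrSets n R m (R v) := by
  have h1 := erase_mem_irrSets hv hA hvA (hR v hv.lt)
  rw [mem_irrSets] at h1 ⊢
  refine ⟨fun a ha => ?_, h1.2⟩
  refine ⟨?_, (h1.1 a ha).2⟩
  rw [mem_irrSets] at hA
  obtain ⟨b, hb1, hb2, hb⟩ := hA.2 v hvA
  have h3 := hb.2.1
  -- `b` starts before `R v` and hence before `a`, so `a` misses `b` only by starting after `b`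
  -- ends.
  have h2 := hb.2.2 a (Finset.mem_of_mem_erase ha) (Finset.ne_of_mem_erase ha)
  have h4 := hR a (h1.1 a ha).2
  have h5 := h1.1 a ha
  unfold Meets at h2 h3
  have := hm b hb1 h3.2 hb.1
  omega

/-- Private neighbours may still lie in the clique, before `R v`; `almostIrrSets` puts no lower
bound on them. -/
theorem mem_almostIrrSets_of_disjoint {v : ℕ} {A : Finset ℕ} (hA : A ∈ irrSets n R p p)
    (h : ∀ a ∈ A, R v ≤ a) : A ∈ almostIrrSets n R (R v) := by
  apply irrSets_subset_almostIrrSets (q := p)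
  rw [mem_irrSets] at hA ⊢
  exact ⟨fun a ha => ⟨h a ha, (hA.1 a ha).2⟩, hA.2⟩

/-- The clique contains no member, or only `v`, or only one of its `R v - p - 1` other vertices. -/
theorem card_irrSets_le_of_large {v : ℕ} (hR : ∀ i < n, i < R i) (hv : IsFirst n R p v) :
    (irrSets n R p p).card ≤ 2 * (almostIrrSets n R (R v)).card +
      (R v - p - 1) * (irrSets n R (R v) (R v)).card := by
  classical
  have hsub : irrSets n R p p ⊆ (almostIrrSets n R (R v) ∪
      (almostIrrSets n R (R v)).image (fun B => insert v B)) ∪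
      ((Finset.Ico p (R v)).erase v).biUnion fun a =>
        (irrSets n R (R v) (R v)).image (fun B => insert a B) := by
    intro A hA
    simp only [Finset.mem_union, Finset.mem_image, Finset.mem_biUnion]
    by_cases h : ∀ a ∈ A, R v ≤ a
    · exact Or.inl (Or.inl (mem_almostIrrSets_of_disjoint hA h))
    · push Not at h
      obtain ⟨a, ha, hav⟩ := h
      have hpa := (mem_irrSets.1 hA).1 a ha
      have key := erase_mem_irrSets hv hA ha hav
      by_cases hva : a = v
      · subst hva
        exact Or.inl (Or.inr ⟨_, irrSets_subset_almostIrrSets key, Finset.insert_erase ha⟩)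
      · refine Or.inr ⟨a, ?_, _, irrSets_mono le_rfl (hv.min a hpa.1 hpa.2) key,
          Finset.insert_erase ha⟩
        simp [hva, hpa.1, hav]
  refine le_trans (Finset.card_le_card hsub) (le_trans (Finset.card_union_le _ _) ?_)
  have hcard : ((Finset.Ico p (R v)).erase v).card = R v - p - 1 := by
    rw [Finset.card_erase_of_mem, Nat.card_Ico]
    simp [hv.le, hR v hv.lt]
  refine Nat.add_le_add ?_ ?_
  · refine le_trans (Finset.card_union_le _ _) ?_
    rw [two_mul]
    exact Nat.add_le_add_left Finset.card_image_le _
  · rw [← hcard]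
    exact Finset.card_biUnion_le_card_mul _ _ _ fun a _ => Finset.card_image_le

/-- The clique is `{v, x}`. If `v` is a member, then `x` is its private neighbour, and the other
members start after `x` ends. The family `S` for sets avoiding the clique is left open: it depends
on whether `x` ends later than `v`. -/
theorem card_irrSets_le_of_pair {v x m : ℕ} {S : Finset (Finset ℕ)} (hR : ∀ i < n, i < R i)
    (hv : IsFirst n R p v) (hvx : ∀ i, p ≤ i → i < R v → i ≠ v → i = x)
    (hm : m ≤ R x)
    (hS : ∀ A ∈ irrSets n R p p, (∀ a ∈ A, R v ≤ a) → A ∈ S) :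
    (irrSets n R p p).card ≤ S.card + (irrSets n R m (R v)).card +
      (irrSets n R (R v) (R x)).card := by
  have hsub : irrSets n R p p ⊆ (S ∪
      (irrSets n R m (R v)).image (fun B => insert v B)) ∪ (irrSets n R (R v) (R x)).image (fun B => insert x B) := by
    intro A hA
    simp only [Finset.mem_union, Finset.mem_image]
    by_cases h : ∀ a ∈ A, R v ≤ a
    · exact Or.inl (Or.inl (hS A hA h))
    · push Not at h
      obtain ⟨a, ha, hav⟩ := h
      have hpa := (mem_irrSets.1 hA).1 a ha
      by_cases hva : a = v
      · subst hva
        refine Or.inl (Or.inr ⟨_, ?_, Finset.insert_erase ha⟩)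
        refine erase_first_mem_irrSets hR hv hA ha fun b h1 h2 h3 => ?_
        rwa [hvx b h1 h2 h3]
      · obtain rfl := hvx a hpa.1 hav hva
        exact Or.inr ⟨_, erase_mem_irrSets hv hA ha hav, Finset.insert_erase ha⟩
  refine le_trans (Finset.card_le_card hsub) (le_trans (Finset.card_union_le _ _) ?_)
  refine Nat.add_le_add ((Finset.card_union_le _ _).trans ?_) Finset.card_image_le
  exact Nat.add_le_add_left Finset.card_image_le _

/-- Neither vertex of the clique reaches beyond it, so neither is a private neighbour of a later
member. -/
theorem mem_irrSets_of_disjoint {v x : ℕ} {A : Finset ℕ}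
    (hvx : ∀ i, p ≤ i → i < R v → i ≠ v → i = x) (hxv : R x = R v)
    (hA : A ∈ irrSets n R p p) (h : ∀ a ∈ A, R v ≤ a) : A ∈ irrSets n R (R v) (R v) := by
  rw [mem_irrSets] at hA ⊢
  refine ⟨fun a ha => ⟨h a ha, (hA.1 a ha).2⟩, fun a ha => ?_⟩
  obtain ⟨b, hb1, hb2, hb⟩ := hA.2 a ha
  refine ⟨b, ?_, hb2, hb⟩
  by_contra hlt
  have h1 := hb.2.1
  have h2 := h a ha
  unfold Meets at h1
  by_cases hbv : b = v
  · subst hbv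
    omega
  · obtain rfl := hvx b hb1 (by omega) hbv
    omega

/-! ### The induction for the bounds with `√3` -/

theorem add_le_sqrt_three_pow (k : ℕ) : √3 + ((k + 3 : ℕ) : ℝ) ≤ √3 ^ (k + 3) := by
  have h3 : √3 * √3 = 3 := Real.mul_self_sqrt (by norm_num)
  have hlo : (1.73 : ℝ) ≤ √3 := Real.le_sqrt_of_sq_le (by norm_num)
  induction k with
  | zero =>
    have : √3 ^ (0 + 3) = 3 * √3 := by linear_combination √3 * h3
    rw [this]
    push_cast
    linarith
  | succ k ih =>
    have : √3 ^ (k + 1 + 3) = √3 ^ (k + 3) * √3 := by ring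
    rw [this]
    have h2 := mul_le_mul_of_nonneg_right ih (Real.sqrt_nonneg 3)
    refine le_trans ?_ h2
    push_cast
    have hk : (0 : ℝ) ≤ k := k.cast_nonneg
    nlinarith

/-- The constant `c = (1 + √3) / 2` solves `c * √3 = c + 1`, so that `card_almostIrrSets_le`
preserves the second bound. For the first, the clique size `R v - p` is 1, 2 or at least 3. -/
theorem card_irrSets_le_and (hR : ∀ i < n, i < R i) (hRn : ∀ i < n, R i ≤ n) :
    ∀ N p, p + N = n → ((irrSets n R p p).card : ℝ) ≤ √3 ^ N ∧
      ((almostIrrSets n R p).card : ℝ) ≤ (1 + √3) / 2 * √3 ^ N := by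
  have h3 : √3 * √3 = 3 := Real.mul_self_sqrt (by norm_num)
  have hlo : (1.73 : ℝ) ≤ √3 := Real.le_sqrt_of_sq_le (by norm_num)
  have hhi : √3 ≤ (1.74 : ℝ) := Real.sqrt_le_iff.2 (by norm_num)
  have hpos : ∀ k : ℕ, (0 : ℝ) < √3 ^ k := fun k => by positivity
  intro N
  induction N using Nat.strong_induction_on with
  | _ N ih =>
  intro p hp
  have ih' : ∀ q, p < q → q ≤ n → ∀ M, q + M = n → ((irrSets n R q q).card : ℝ) ≤ √3 ^ M ∧
      ((almostIrrSets n R q).card : ℝ) ≤ (1 + √3) / 2 * √3 ^ M :=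
    fun q h1 h2 M hM => ih M (by omega) q hM
  rcases Nat.eq_zero_or_pos N with rfl | hN
  · have h1 := Finset.card_le_card (irrSets_of_le (n := n) (R := R) (p := p) (q := p) (by omega))
    have h2 := Finset.card_le_card (almostIrrSets_of_le (n := n) (R := R) (p := p) (by omega))
    rw [Finset.card_singleton] at h1 h2
    have h1' : ((irrSets n R p p).card : ℝ) ≤ 1 := by exact_mod_cast h1
    have h2' : ((almostIrrSets n R p).card : ℝ) ≤ 1 := by exact_mod_cast h2
    constructor <;> simp only [pow_zero] <;> linarith
  obtain ⟨M, rfl⟩ : ∃ M, N = M + 1 := ⟨N - 1, by omega⟩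
  refine ⟨?_, ?_⟩
  swap
  · obtain ⟨h1, h2⟩ := ih' (p + 1) (by omega) (by omega) M (by omega)
    have h := card_almostIrrSets_le (p := p) hR
    have h' : ((almostIrrSets n R p).card : ℝ) ≤ (almostIrrSets n R (p + 1)).card +
      (irrSets n R (p + 1) (p + 1)).card := by exact_mod_cast h
    refine h'.trans ((add_le_add h2 h1).trans (le_of_eq ?_))
    linear_combination (-(√3 ^ M) / 2) * h3
  obtain ⟨v, hv⟩ := exists_isFirst (n := n) (R := R) (p := p) (by omega)
  have hvR := hR v hv.lt
  have hvn := hRn v hv.lt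
  have hpv := hv.le
  rcases (show R v = p + 1 ∨ R v = p + 2 ∨ p + 3 ≤ R v by omega) with hk | hk | hk
  · have : v = p := by omega
    subst this
    have h1 := (ih' (v + 1) (by omega) (by omega) M (by omega)).1
    have h2 : ((irrSets n R v v).card : ℝ) ≤ (irrSets n R (v + 1) (v + 1)).card := by
      exact_mod_cast Finset.card_le_card (irrSets_subset_succ hk)
    have : √3 ^ (M + 1) = √3 ^ M * √3 := pow_succ _ _
    nlinarith [hpos M]
  · obtain ⟨K, rfl⟩ : ∃ K, M = K + 1 := ⟨M - 1, by omega⟩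
    obtain ⟨x, hxp, hxR, hvx⟩ : ∃ x, p ≤ x ∧ x < R v ∧
        ∀ i, p ≤ i → i < R v → i ≠ v → i = x := by
      rcases (show v = p ∨ v = p + 1 by omega) with h | h
      · exact ⟨p + 1, by omega, by omega, fun i _ _ _ => by omega⟩
      · exact ⟨p, by omega, by omega, fun i _ _ _ => by omega⟩
    have hpow : √3 ^ (K + 1 + 1) = √3 ^ K * 3 := by linear_combination √3 ^ K * h3
    have hxmin := hv.min x hxp (by omega)
    have hxn := hRn x (by omega)
    obtain ⟨hT2, hD2⟩ := ih' (p + 2) (by omega) (by omega) K (by omega)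
    rcases hxmin.eq_or_lt with hxv | hxv
    · have h := card_irrSets_le_of_pair hR hv hvx (m := R v) hxmin
        (fun A => mem_irrSets_of_disjoint hvx hxv.symm)
      rw [← hxv, hk] at h
      have h' : ((irrSets n R p p).card : ℝ) ≤ (irrSets n R (p + 2) (p + 2)).card +
        (irrSets n R (p + 2) (p + 2)).card + (irrSets n R (p + 2) (p + 2)).card := by
          exact_mod_cast h
      rw [hpow]
      linarith
    · obtain ⟨J, rfl⟩ : ∃ J, K = J + 1 := ⟨K - 1, by omega⟩
      -- Now `x` ends later than `v`. The three terms become `D` at `p + 2`, `D` at `p + 3`, and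
      -- sets from `p + 2` with private neighbours from `p + 3` on.
      have h := card_irrSets_le_of_pair hR hv hvx (m := p + 3) (by omega)
        (fun A => mem_almostIrrSets_of_disjoint)
      rw [hk] at h
      have hZ := Finset.card_le_card
        (irrSets_mono (n := n) (R := R) (le_refl (p + 2)) (show p + 3 ≤ R x by omega))
      have hD := Finset.card_le_card
        (irrSets_subset_almostIrrSets (n := n) (R := R) (p := p + 3) (q := p + 2))
      obtain ⟨hT3, hD3⟩ := ih' (p + 3) (by omega) (by omega) J (by omega)
      -- The constant comes from `T` at `p + 3` plus `D` at `p + 5`, the latter contributing `(1 +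
      -- √3) / 2` divided by `√3 ^ 2`. The case `R w = p + 4` gives only `(1 + √3) / 2`.
      have hZ3 : ((irrSets n R (p + 2) (p + 3)).card : ℝ) ≤
          (1 + (1 + √3) / 6) * √3 ^ J := by
        rcases Nat.eq_zero_or_pos J with rfl | hJ
        · have h1 := Finset.card_le_card
            (irrSets_of_le (n := n) (R := R) (p := p + 2) (q := p + 3) (by omega))
          rw [Finset.card_singleton] at h1
          have h1' : ((irrSets n R (p + 2) (p + 3)).card : ℝ) ≤ 1 := by exact_mod_cast h1
          simp only [pow_zero]
          linarith
        obtain ⟨w, hw⟩ := exists_isFirst (n := n) (R := R) (p := p + 3) (by omega)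
        have hwR := hR w hw.lt
        have hwn := hRn w hw.lt
        have hpw := hw.le
        have hz : ((irrSets n R (p + 2) (p + 3)).card : ℝ) ≤
          (irrSets n R (p + 3) (p + 3)).card + (almostIrrSets n R (R w)).card := by
            exact_mod_cast card_irrSets_succ_le hR hw
        obtain ⟨I, rfl⟩ : ∃ I, J = I + 1 := ⟨J - 1, by omega⟩
        rcases (show R w = p + 4 ∨ p + 5 ≤ R w by omega) with hw4 | hw5
        · have hw3 : w = p + 3 := by omega
          rw [hw3] at hw4
          have h1 : ((irrSets n R (p + 3) (p + 3)).card : ℝ) ≤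
            (irrSets n R (p + 4) (p + 4)).card := by
              exact_mod_cast Finset.card_le_card (irrSets_subset_succ hw4)
          obtain ⟨hT4, hD4⟩ := ih' (p + 4) (by omega) (by omega) I (by omega)
          rw [hw3, hw4] at hz
          have hpowI : √3 ^ (I + 1) = √3 ^ I * √3 := pow_succ _ _
          rw [hpowI]
          nlinarith [hpos I]
        · obtain ⟨H, rfl⟩ : ∃ H, I = H + 1 := ⟨I - 1, by omega⟩
          obtain ⟨hT5, hD5⟩ := ih' (p + 5) (by omega) (by omega) H (by omega)
          have h1 : ((almostIrrSets n R (R w)).card : ℝ) ≤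
            (almostIrrSets n R (p + 5)).card := by
              exact_mod_cast Finset.card_le_card (almostIrrSets_mono hw5)
          have hpowH : √3 ^ (H + 1 + 1) = √3 ^ H * 3 := by linear_combination √3 ^ H * h3
          rw [hpowH] at hT3 ⊢
          nlinarith [hpos H]
      have hpowJ : √3 ^ (J + 1) = √3 ^ J * √3 := pow_succ _ _
      have h' : ((irrSets n R p p).card : ℝ) ≤ (almostIrrSets n R (p + 2)).card +
        (almostIrrSets n R (p + 3)).card + (irrSets n R (p + 2) (p + 3)).card := by
          exact_mod_cast h.trans (by omega)
      rw [hpow, hpowJ]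
      rw [hpowJ] at hD2
      have hJ := hpos J
      -- The two sides are about 5.187 and 5.196.
      have hfin : (1 + √3) / 2 * √3 + (1 + √3) / 2 + (1 + (1 + √3) / 6) ≤ √3 * 3 := by
        nlinarith
      nlinarith
  · have h := card_irrSets_le_of_large hR hv
    obtain ⟨k, hk'⟩ : ∃ k, R v = p + (k + 3) := ⟨R v - p - 3, by omega⟩
    obtain ⟨L, hL⟩ : ∃ L, M + 1 = L + (k + 3) := ⟨M + 1 - (k + 3), by omega⟩
    obtain ⟨hT, hD⟩ := ih' (R v) (by omega) (by omega) L (by omega)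
    have h' : ((irrSets n R p p).card : ℝ) ≤ 2 * (almostIrrSets n R (R v)).card +
      ((k + 2 : ℕ) : ℝ) * (irrSets n R (R v) (R v)).card := by
        have : R v - p - 1 = k + 2 := by omega
        rw [this] at h
        exact_mod_cast h
    -- The recurrence yields the factor `2 * ((1 + √3) / 2) + (k + 2) = √3 + (k + 3)`.
    have h1 := add_le_sqrt_three_pow k
    rw [hL, pow_add]
    have h2 : ((k + 2 : ℕ) : ℝ) * (irrSets n R (R v) (R v)).card ≤ ((k + 2 : ℕ) : ℝ) * √3 ^ L := by
      gcongr
    have h3 := mul_le_mul_of_nonneg_left h1 (hpos L).le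
    push_cast at h2 h3 h' ⊢
    nlinarith

end IntervalModel

/-! ### Minimal Roman dominating functions and open irredundant sets -/

section Characterization

variable {V : Type*} (G : SimpleGraph V)

/-- Every member of `A` has an external private neighbour. -/
def IsOpenIrredundant (A : Set V) : Prop :=
  ∀ v ∈ A, ∃ u, u ∉ A ∧ G.Adj v u ∧ ∀ w ∈ A, G.Adj w u → w = v

open Classical in
/-- The function that is `2` on `A`, `0` on the other vertices dominated by `A`, `1` elsewhere. -/
noncomputable def rdfOfSet (A : Set V) (v : V) : Fin 3 :=
  if v ∈ A then 2 else if ∃ w ∈ A, G.Adj v w then 0 else 1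

variable {G}

theorem IsOpenIrredundant.mono {A B : Set V} (h : IsOpenIrredundant G B) (hAB : A ⊆ B) :
    IsOpenIrredundant G A := by
  intro v hv
  obtain ⟨u, h1, h2, h3⟩ := h v (hAB hv)
  exact ⟨u, fun hu => h1 (hAB hu), h2, fun w hw => h3 w (hAB hw)⟩

@[simp]
theorem rdfOfSet_eq_two_iff {A : Set V} {v : V} : rdfOfSet G A v = 2 ↔ v ∈ A := by
  unfold rdfOfSet
  split_ifs <;> simp_all

theorem rdfOfSet_eq_zero_iff {A : Set V} {v : V} :
    rdfOfSet G A v = 0 ↔ v ∉ A ∧ ∃ w ∈ A, G.Adj v w := by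
  unfold rdfOfSet
  split_ifs <;> simp_all

/-- A smaller Roman dominating `g` takes the value 2 only on `A`. It vanishes at the private
neighbour of `v ∈ A`, and the neighbour of value 2 needed there can only be `v`, so `g v = 2`. -/
theorem isMinimalRdf_rdfOfSet {A : Set V} (hA : IsOpenIrredundant G A) :
    IsMinimalRdf G (rdfOfSet G A) := by
  refine ⟨fun v hv => ?_, fun g hg hgf v => ?_⟩
  · obtain ⟨-, w, hw, hvw⟩ := rdfOfSet_eq_zero_iff.1 hv
    exact ⟨w, hvw, rdfOfSet_eq_two_iff.2 hw⟩
  · have htwo : ∀ w, g w = 2 → w ∈ A := fun w hw => by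
      have : g w ≤ rdfOfSet G A w := hgf w
      rw [hw] at this
      rw [← rdfOfSet_eq_two_iff (G := G)]
      omega
    by_cases hv : v ∈ A
    · obtain ⟨u, h1, h2, h3⟩ := hA v hv
      have hu : rdfOfSet G A u = 0 := rdfOfSet_eq_zero_iff.2 ⟨h1, v, hv, h2.symm⟩
      have hgu : g u = 0 := by
        have : g u ≤ rdfOfSet G A u := hgf u
        rw [hu] at this
        omega
      obtain ⟨w, hw1, hw2⟩ := hg u hgu
      obtain rfl := h3 w (htwo w hw2) hw1.symm
      rw [hw2]
      exact Fin.le_last _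
    · by_cases hgv : g v = 0
      · obtain ⟨w, hw1, hw2⟩ := hg v hgv
        rw [rdfOfSet_eq_zero_iff.2 ⟨hv, w, htwo w hw2, hw1⟩]
        exact Fin.zero_le _
      · have : rdfOfSet G A v ≠ 2 := fun h => hv (rdfOfSet_eq_two_iff.1 h)
        change rdfOfSet G A v ≤ g v
        omega

/-- Without an external private neighbour of `v`, the value of `v` could be lowered from 2 to 1. -/
theorem IsMinimalRdf.isOpenIrredundant {f : V → Fin 3} (hf : IsMinimalRdf G f) :
    IsOpenIrredundant G {v | f v = 2} := by
  classical
  intro v hv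
  by_contra! hcon
  have hv : f v = 2 := hv
  have hg : IsRomanDominating G (Function.update f v 1) := by
    intro u hu
    by_cases huv : u = v
    · subst huv
      simp at hu
    · rw [Function.update_of_ne huv] at hu
      obtain ⟨w, hw1, hw2⟩ := hf.1 u hu
      by_cases hwv : w = v
      · subst hwv
        obtain ⟨w', h1, h2, h3⟩ := hcon u (by simp [hu]) hw1.symm
        exact ⟨w', h2.symm, by rw [Function.update_of_ne h3]; exact h1⟩
      · exact ⟨w, hw1, by rw [Function.update_of_ne hwv]; exact hw2⟩
  have hle := hf.2 hg (by
    intro u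
    by_cases huv : u = v
    · subst huv
      simp [hv]
    · rw [Function.update_of_ne huv]) v
  simp [hv] at hle

/-- A value 1 next to a 2 could be lowered to 0, and a 0 cannot occur without a neighbour of value
2. -/
theorem IsMinimalRdf.eq_rdfOfSet {f : V → Fin 3} (hf : IsMinimalRdf G f) :
    f = rdfOfSet G {v | f v = 2} := by
  classical
  funext v
  unfold rdfOfSet
  simp only [Set.mem_ofPred_eq]
  split_ifs with h2 h0
  · exact h2
  · by_contra hv
    obtain ⟨w, hw2, hvw⟩ := h0
    have hg : IsRomanDominating G (Function.update f v 0) := by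
      intro u hu
      by_cases huv : u = v
      · subst huv
        exact ⟨w, hvw, by rw [Function.update_of_ne hvw.ne']; exact hw2⟩
      · rw [Function.update_of_ne huv] at hu
        obtain ⟨w', h1, h3⟩ := hf.1 u hu
        refine ⟨w', h1, ?_⟩
        rw [Function.update_of_ne]
        · exact h3
        · rintro rfl
          exact h2 h3
    have hle := hf.2 hg (by
      intro u
      by_cases huv : u = v
      · subst huv
        simp
      · rw [Function.update_of_ne huv]) v
    simp at hle
    omega
  · by_contra hv
    have : f v = 0 := by omega
    obtain ⟨w, hw1, hw2⟩ := hf.1 v this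
    exact h0 ⟨w, hw2, hw1⟩

end Characterization

/-! ### Disjoint unions of paths on two vertices -/

theorem disjointUnionP2_adj {k : ℕ} {x y : Fin k × Fin 2} :
    (disjointUnionP2 k).Adj x y ↔ x.1 = y.1 ∧ x.2 ≠ y.2 := by
  obtain ⟨i, a⟩ := x
  obtain ⟨j, b⟩ := y
  simp only [disjointUnionP2, SimpleGraph.pathGraph_adj]
  refine and_congr_right fun _ => ?_
  omega

/-- Both vertices of copy `i` are represented by the one-point interval at `i`. -/
theorem isIntervalGraph_disjointUnionP2 (k : ℕ) : IsIntervalGraph (disjointUnionP2 k) := by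
  refine ⟨fun x => (x.1 : ℕ), fun x => (x.1 : ℕ), fun _ => le_rfl, fun u v => ?_⟩
  rw [disjointUnionP2_adj, Set.Icc_self, Set.Icc_self, Set.singleton_inter_nonempty]
  simp only [Set.mem_singleton_iff, Nat.cast_inj, Fin.val_inj, Ne, Prod.ext_iff]
  tauto

/-- Since `rev` is `2 - ·`, the condition says that the values on each edge add up to at least 2.
Minimality below means a sum of exactly 2, so one value on each edge is free. -/
theorem isRomanDominating_disjointUnionP2_iff {k : ℕ} {f : Fin k × Fin 2 → Fin 3} :
    IsRomanDominating (disjointUnionP2 k) f ↔ ∀ i, (f (i, 1)).rev ≤ f (i, 0) := by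
  have key : ∀ x y : Fin 3, y.rev ≤ x ↔ (x = 0 → y = 2) ∧ (y = 0 → x = 2) := by decide
  simp only [key]
  constructor
  · intro h i
    constructor
    · intro h0
      obtain ⟨⟨j, b⟩, h1, h2⟩ := h (i, 0) h0
      rw [disjointUnionP2_adj] at h1
      obtain ⟨rfl, h1⟩ := h1
      have : b = 1 := by
        simp only at h1
        omega
      rwa [this] at h2
    · intro h0
      obtain ⟨⟨j, b⟩, h1, h2⟩ := h (i, 1) h0
      rw [disjointUnionP2_adj] at h1
      obtain ⟨rfl, h1⟩ := h1
      have : b = 0 := by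
        simp only at h1
        omega
      rwa [this] at h2
  · rintro h ⟨i, a⟩ h0
    rcases (show a = 0 ∨ a = 1 by omega) with rfl | rfl
    · exact ⟨(i, 1), disjointUnionP2_adj.2 ⟨rfl, by simp⟩, (h i).1 h0⟩
    · exact ⟨(i, 0), disjointUnionP2_adj.2 ⟨rfl, by simp⟩, (h i).2 h0⟩

theorem isMinimalRdf_disjointUnionP2_iff {k : ℕ} {f : Fin k × Fin 2 → Fin 3} :
    IsMinimalRdf (disjointUnionP2 k) f ↔ ∀ i, f (i, 0) = (f (i, 1)).rev := by
  constructor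
  · intro hf i
    have h1 := isRomanDominating_disjointUnionP2_iff.1 hf.1
    refine le_antisymm ?_ (h1 i)
    -- The competitor lowers the first value on every edge until the sum is 2.
    refine hf.2 (y := fun x => if x.2 = 0 then (f (x.1, 1)).rev else f x) ?_ ?_ (i, 0)
    · rw [isRomanDominating_disjointUnionP2_iff]
      intro j
      simp
    · rintro ⟨j, a⟩
      dsimp only
      split_ifs with ha
      · rw [ha]
        exact h1 j
      · exact le_rfl
  · intro h
    refine ⟨isRomanDominating_disjointUnionP2_iff.2 fun i => (h i).ge, fun g hg hgf => ?_⟩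
    rw [isRomanDominating_disjointUnionP2_iff] at hg
    rintro ⟨i, a⟩
    have h0 := hgf (i, 0)
    have h1 := hgf (i, 1)
    have h2 := hg i
    have h3 := h i
    rcases (show a = 0 ∨ a = 1 by omega) with rfl | rfl
    · rw [h3]
      exact (Fin.rev_le_rev.2 h1).trans h2
    · rw [h3] at h0
      exact Fin.rev_le_rev.1 (h2.trans h0)

theorem ncard_isMinimalRdf_disjointUnionP2 (k : ℕ) :
    {f | IsMinimalRdf (disjointUnionP2 k) f}.ncard = 3 ^ k := by
  let F : (Fin k → Fin 3) → Fin k × Fin 2 → Fin 3 :=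
    fun h x => if x.2 = 0 then (h x.1).rev else h x.1
  have hF : Function.Injective F := by
    intro h h' hh
    funext i
    have := congrFun hh (i, 1)
    simpa [F] using this
  have : {f | IsMinimalRdf (disjointUnionP2 k) f} = Set.range F := by
    ext f
    rw [Set.mem_ofPred_eq, isMinimalRdf_disjointUnionP2_iff, Set.mem_range]
    constructor
    · intro h
      refine ⟨fun i => f (i, 1), ?_⟩
      funext ⟨i, a⟩
      rcases (show a = 0 ∨ a = 1 by omega) with rfl | rfl
      · simp [F, h i]
      · simp [F]
    · rintro ⟨h, rfl⟩ i
      simp [F]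
  rw [this, ← Set.image_univ, Set.ncard_image_of_injective _ hF, Set.ncard_univ]
  simp

/-! ### The number of minimal Roman dominating functions of an interval graph -/

/-- The indices `i` with `l i ≤ x` form an initial segment, so their number is a threshold. -/
theorem lt_card_filter_iff_of_monotone {n : ℕ} {l : Fin n → ℝ} (hl : Monotone l) (x : ℝ)
    (j : Fin n) : (j : ℕ) < (Finset.univ.filter fun i => l i ≤ x).card ↔ l j ≤ x := by
  constructor
  · intro h
    by_contra hj
    have hsub : (Finset.univ.filter fun i => l i ≤ x) ⊆ Finset.Iio j := by
      intro i hi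
      rw [Finset.mem_filter] at hi
      rw [Finset.mem_Iio]
      by_contra hij
      exact hj ((hl (not_lt.1 hij)).trans hi.2)
    have := Finset.card_le_card hsub
    rw [Fin.card_Iio] at this
    omega
  · intro h
    have hsub : Finset.Iic j ⊆ Finset.univ.filter fun i => l i ≤ x := by
      intro i hi
      rw [Finset.mem_Iic] at hi
      simpa using (hl hi).trans h
    have := Finset.card_le_card hsub
    rw [Fin.card_Iic] at this
    omega

theorem IsIntervalGraph.exists_meets {V : Type*} [Fintype V] {G : SimpleGraph V}
    (hG : IsIntervalGraph G) :
    ∃ (e : Fin (Fintype.card V) ≃ V) (R : ℕ → ℕ),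
      (∀ i < Fintype.card V, i < R i ∧ R i ≤ Fintype.card V) ∧
      ∀ i j : Fin (Fintype.card V), IntervalModel.Meets R i j ↔ i = j ∨ G.Adj (e i) (e j) := by
  obtain ⟨l, r, hlr, hadj⟩ := hG
  let e₀ : Fin (Fintype.card V) ≃ V := (Fintype.equivFin V).symm
  let e : Fin (Fintype.card V) ≃ V := (Tuple.sort (l ∘ e₀)).trans e₀
  have hmono : Monotone (l ∘ e) := Tuple.monotone_sort (l ∘ e₀)
  let R : ℕ → ℕ := fun i => if h : i < Fintype.card V then
    (Finset.univ.filter fun j => (l ∘ e) j ≤ r (e ⟨i, h⟩)).card else 0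
  have hR : ∀ i j : Fin (Fintype.card V), (j : ℕ) < R i ↔ l (e j) ≤ r (e i) := by
    intro i j
    simp only [R, i.2, dif_pos]
    exact lt_card_filter_iff_of_monotone hmono _ j
  refine ⟨e, R, fun i hi => ⟨(hR ⟨i, hi⟩ ⟨i, hi⟩).2 (hlr _), ?_⟩, fun i j => ?_⟩
  · simp only [R, hi, dif_pos]
    exact (Finset.card_le_univ _).trans (by simp)
  · unfold IntervalModel.Meets
    rw [hR, hR, hadj, Set.Icc_inter_Icc, Set.nonempty_Icc, sup_le_iff, le_inf_iff, le_inf_iff,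
      Ne, e.injective.eq_iff]
    have h1 := hlr (e i)
    have h2 := hlr (e j)
    constructor
    · rintro ⟨h3, h4⟩
      by_cases hij : i = j
      · exact Or.inl hij
      · exact Or.inr ⟨hij, ⟨h1, h3⟩, h4, h2⟩
    · rintro (rfl | ⟨-, ⟨-, h3⟩, h4, -⟩)
      · exact ⟨h1, h1⟩
      · exact ⟨h3, h4⟩

/-- The positions of value 2 form a member of `irrSets n R 0 0` for `n` the order of the graph, and
they determine the function. -/
theorem IsIntervalGraph.ncard_isMinimalRdf_le {V : Type*} [Fintype V] {G : SimpleGraph V}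
    (hG : IsIntervalGraph G) :
    ({f | IsMinimalRdf G f}.ncard : ℝ) ≤ √3 ^ Fintype.card V := by
  classical
  obtain ⟨e, R, hR, hmeets⟩ := hG.exists_meets
  refine le_trans ?_ (IntervalModel.card_irrSets_le_and (fun i hi => (hR i hi).1)
    (fun i hi => (hR i hi).2) (Fintype.card V) 0 (zero_add _)).1
  rw [← Set.ncard_coe_finset, Nat.cast_le]
  let S : (V → Fin 3) → Finset ℕ := fun f =>
    (Finset.univ.filter fun i => f (e i) = 2).map Fin.valEmbedding
  have hS : ∀ f (i : Fin (Fintype.card V)), (i : ℕ) ∈ S f ↔ f (e i) = 2 := by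
    intro f i
    simp [S, ← Fin.ext_iff]
  have hlt : ∀ f, ∀ i ∈ S f, i < Fintype.card V := by
    intro f i hi
    simp only [S, Finset.mem_map] at hi
    obtain ⟨j, -, rfl⟩ := hi
    exact j.2
  refine Set.ncard_le_ncard_of_injOn S ?_ ?_ (Finset.finite_toSet _)
  · intro f hf
    have hf : IsMinimalRdf G f := hf
    rw [Finset.mem_coe, IntervalModel.mem_irrSets]
    refine ⟨fun a ha => ⟨Nat.zero_le _, hlt f a ha⟩, fun a ha => ?_⟩
    obtain ⟨a, rfl⟩ : ∃ a' : Fin (Fintype.card V), (a' : ℕ) = a := ⟨⟨a, hlt f a ha⟩, rfl⟩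
    obtain ⟨u, h1, h2, h3⟩ := hf.isOpenIrredundant (e a) ((hS f a).1 ha)
    obtain ⟨b, rfl⟩ := e.surjective u
    refine ⟨b, Nat.zero_le _, b.2, ?_, (hmeets a b).2 (Or.inr h2), ?_⟩
    · rw [Ne, Fin.val_inj]
      rintro rfl
      exact h2.ne rfl
    · intro a' ha' hne hm
      obtain ⟨a', rfl⟩ : ∃ x : Fin (Fintype.card V), (x : ℕ) = a' := ⟨⟨a', hlt f a' ha'⟩, rfl⟩
      rw [hS] at ha'
      rcases (hmeets a' b).1 hm with rfl | h
      · exact h1 ha'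
      · exact hne (by rw [e.injective (h3 _ ha' h)])
  · intro f hf g hg hfg
    have hf : IsMinimalRdf G f := hf
    have hg : IsMinimalRdf G g := hg
    rw [hf.eq_rdfOfSet, hg.eq_rdfOfSet]
    congr 1
    ext v
    obtain ⟨i, rfl⟩ := e.surjective v
    rw [Set.mem_ofPred_eq, Set.mem_ofPred_eq, ← hS f i, ← hS g i, hfg]

/-! ### Structured programs for random access machines -/

namespace RAM

/-- Instructions that always continue with the next line. -/
def Instr.Straight : Instr → Prop
  | .jump _ => False
  | .jzero _ _ => False
  | _ => True

/-- Structured programs. -/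
inductive Cmd where
  /-- a sequence of instructions without jumps -/
  | block (l : List Instr)
  /-- sequential composition -/
  | seq (c d : Cmd)
  /-- if `R[a] = 0` then `c` else `d` -/
  | ite (a : ℕ) (c d : Cmd)
  /-- while `R[a] ≠ 0` do `c` -/
  | loop (a : ℕ) (c : Cmd)

/-- The number of lines of the compiled program. -/
def Cmd.size : Cmd → ℕ
  | .block l => l.length
  | .seq c d => c.size + d.size
  | .ite _ c d => c.size + d.size + 2
  | .loop _ c => c.size + 2

/-- The program lines for a structured program whose first line has number `k`. -/
def Cmd.compile : Cmd → ℕ → Program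
  | .block l, _ => l
  | .seq c d, k => c.compile k ++ d.compile (k + c.size)
  | .ite a c d, k => .jzero a (k + d.size + 2) :: (d.compile (k + 1) ++
      .jump (k + d.size + 2 + c.size) :: c.compile (k + d.size + 2))
  | .loop a c, k => .jzero a (k + c.size + 2) :: (c.compile (k + 1) ++ [.jump k])

theorem Cmd.length_compile (c : Cmd) (k : ℕ) : (c.compile k).length = c.size := by
  induction c generalizing k with
  | block l => rfl
  | seq c d hc hd => simp [compile, size, hc, hd]
  | ite a c d hc hd => simp [compile, size, hc, hd]; omega
  | loop a c hc => simp [compile, size, hc]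

/-- The configuration `s` at line `k`. -/
def Cfg.at (s : Cfg) (k : ℕ) : Cfg := { s with pc := k }

@[simp] theorem Cfg.at_pc (s : Cfg) (k : ℕ) : (s.at k).pc = k := rfl
@[simp] theorem Cfg.at_outs (s : Cfg) (k : ℕ) : (s.at k).outs = s.outs := rfl

/-- Wherever the code of `c` is placed, it leads from `s` to `s'` in `t` steps; program lines of
configurations are ignored. -/
def Cmd.Runs (x : List ℕ) (c : Cmd) (s : Cfg) (t : ℕ) (s' : Cfg) : Prop :=
  ∀ pre post : Program, (step (pre ++ c.compile pre.length ++ post) x)^[t] (s.at pre.length) =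
    s'.at (pre.length + c.size)

/-- The program `c` started in `s` arrives within `T` steps at a state that satisfies `Q`. -/
def Cmd.Reach (x : List ℕ) (c : Cmd) (s : Cfg) (T : ℕ) (Q : Cfg → Prop) : Prop :=
  ∃ t s', t ≤ T ∧ c.Runs x s t s' ∧ Q s'

theorem Cmd.Reach.mono {x : List ℕ} {c : Cmd} {s : Cfg} {T T' : ℕ} {Q Q' : Cfg → Prop}
    (h : c.Reach x s T Q) (hT : T ≤ T') (hQ : ∀ s', Q s' → Q' s') : c.Reach x s T' Q' := by
  obtain ⟨t, s', h1, h2, h3⟩ := h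
  exact ⟨t, s', h1.trans hT, h2, hQ s' h3⟩

theorem step_of_getElem? {P : Program} {x : List ℕ} {c : Cfg} {i : Instr}
    (h : P[c.pc]? = some i) : step P x c = i.exec x c := by
  simp [step, h]

theorem Instr.Straight.exec_at {i : Instr} (hi : i.Straight) (x : List ℕ) (s : Cfg) (k : ℕ) :
    i.exec x (s.at k) = (i.exec x s).at (k + 1) := by
  cases i <;> first | exact hi.elim | rfl

theorem Cmd.runs_block {x : List ℕ} {l : List Instr} (hl : ∀ i ∈ l, i.Straight) (s : Cfg) :
    (Cmd.block l).Runs x s l.length (l.foldl (fun s i => i.exec x s) s) := by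
  intro pre post
  simp only [compile, size]
  induction l generalizing s pre with
  | nil => simp
  | cons i l ih =>
    have h1 : step (pre ++ i :: l ++ post) x (s.at pre.length) =
        (i.exec x s).at (pre.length + 1) := by
      rw [step_of_getElem? (i := i) (by simp), (hl i (by simp)).exec_at]
    have h2 := ih (fun j hj => hl j (by simp [hj])) (i.exec x s) (pre ++ [i])
    simp only [List.length_append, List.length_singleton, List.append_assoc,
      List.cons_append, List.nil_append] at h2
    simp only [List.append_assoc, List.cons_append] at h1
    rw [List.length_cons, Function.iterate_succ_apply]
    simp only [List.append_assoc, List.cons_append, List.foldl_cons]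
    rw [h1, h2]
    congr 1
    omega

theorem Cmd.Reach.block {x : List ℕ} {l : List Instr} {s : Cfg} {Q : Cfg → Prop}
    (hl : ∀ i ∈ l, i.Straight) (hQ : Q (l.foldl (fun s i => i.exec x s) s)) :
    (Cmd.block l).Reach x s l.length Q :=
  ⟨_, _, le_rfl, runs_block hl s, hQ⟩

theorem Cmd.Runs.seq {x : List ℕ} {c d : Cmd} {s s' s'' : Cfg} {t t' : ℕ}
    (h : c.Runs x s t s') (h' : d.Runs x s' t' s'') : (c.seq d).Runs x s (t + t') s'' := by
  intro pre post
  have h1 := h pre (d.compile (pre.length + c.size) ++ post)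
  have h2 := h' (pre ++ c.compile pre.length) post
  simp only [List.length_append, length_compile, List.append_assoc] at h1 h2
  rw [add_comm t t', Function.iterate_add_apply]
  simp only [compile, size, List.append_assoc]
  rw [h1, h2]
  congr 1
  omega

theorem Cmd.Reach.seq {x : List ℕ} {c d : Cmd} {s : Cfg} {T T' : ℕ} {Q : Cfg → Prop}
    (h : c.Reach x s T fun s' => d.Reach x s' T' Q) : (c.seq d).Reach x s (T + T') Q := by
  obtain ⟨t, s', h1, h2, t', s'', h3, h4, h5⟩ := h
  exact ⟨t + t', s'', add_le_add h1 h3, h2.seq h4, h5⟩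

theorem Cmd.Runs.ite_zero {x : List ℕ} {c d : Cmd} {s s' : Cfg} {t a : ℕ}
    (ha : s.mem a = 0) (h : c.Runs x s t s') : (Cmd.ite a c d).Runs x s (t + 1) s' := by
  intro pre post
  have h1 := h (pre ++ Instr.jzero a (pre.length + d.size + 2) :: (d.compile (pre.length + 1) ++
    [Instr.jump (pre.length + d.size + 2 + c.size)])) post
  have hlen : (pre ++ Instr.jzero a (pre.length + d.size + 2) :: (d.compile (pre.length + 1) ++
    [Instr.jump (pre.length + d.size + 2 + c.size)])).length = pre.length + d.size + 2 := by
      simp [length_compile]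
      omega
  rw [hlen] at h1
  simp only [List.append_assoc, List.cons_append, List.nil_append] at h1
  rw [Function.iterate_succ_apply]
  simp only [compile, size, List.append_assoc, List.cons_append]
  rw [step_of_getElem? (i := Instr.jzero a (pre.length + d.size + 2)) (by simp)]
  have : (Instr.jzero a (pre.length + d.size + 2)).exec x (s.at pre.length) =
      s.at (pre.length + d.size + 2) := by
    simp [Instr.exec, Cfg.at, ha]
  rw [this, h1]
  congr 1
  omega

theorem getElem?_append_cons_append_cons {α : Type*} (l l' l'' : List α) (i j : α) :
    (l ++ i :: (l' ++ j :: l''))[l.length + 1 + l'.length]? = some j := by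
  rw [add_assoc, List.getElem?_append_right (by omega), Nat.add_sub_cancel_left, add_comm 1]
  simp

theorem Cmd.Runs.ite_pos {x : List ℕ} {c d : Cmd} {s s' : Cfg} {t a : ℕ}
    (ha : s.mem a ≠ 0) (h : d.Runs x s t s') : (Cmd.ite a c d).Runs x s (t + 2) s' := by
  intro pre post
  have h1 := h (pre ++ [Instr.jzero a (pre.length + d.size + 2)])
    (Instr.jump (pre.length + d.size + 2 + c.size) ::
      (c.compile (pre.length + d.size + 2) ++ post))
  simp only [List.length_append, List.length_singleton, List.append_assoc,
    List.cons_append, List.nil_append] at h1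
  rw [Function.iterate_succ_apply]
  simp only [compile, size, List.append_assoc, List.cons_append]
  rw [step_of_getElem? (i := Instr.jzero a (pre.length + d.size + 2)) (by simp)]
  have : (Instr.jzero a (pre.length + d.size + 2)).exec x (s.at pre.length) =
      s.at (pre.length + 1) := by
    simp [Instr.exec, Cfg.at, ha]
  rw [this, Function.iterate_succ_apply', h1,
    step_of_getElem? (i := Instr.jump (pre.length + d.size + 2 + c.size))]
  · simp only [Instr.exec, Cfg.at]
    congr 1
    omega
  · rw [← length_compile d (pre.length + 1)]
    exact getElem?_append_cons_append_cons ..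

theorem Cmd.Runs.loop_zero {x : List ℕ} {c : Cmd} {s : Cfg} {a : ℕ}
    (ha : s.mem a = 0) : (Cmd.loop a c).Runs x s 1 s := by
  intro pre post
  simp only [compile, size, List.append_assoc, List.cons_append, Function.iterate_one]
  rw [step_of_getElem? (i := Instr.jzero a (pre.length + c.size + 2)) (by simp)]
  simp [Instr.exec, Cfg.at, ha, add_assoc]

/-- One pass leads back to the loop head. This gives access to the configurations between rounds,
which delay and space require. -/
theorem Cmd.Runs.loop_body {x : List ℕ} {c : Cmd} {s s' : Cfg} {t a : ℕ}
    (ha : s.mem a ≠ 0) (h : c.Runs x s t s') (pre post : Program) :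
    (step (pre ++ (Cmd.loop a c).compile pre.length ++ post) x)^[t + 2] (s.at pre.length) =
      s'.at pre.length := by
  have h1 := h (pre ++ [Instr.jzero a (pre.length + c.size + 2)])
    (Instr.jump pre.length :: post)
  simp only [List.length_append, List.length_singleton, List.append_assoc,
    List.cons_append, List.nil_append] at h1
  rw [Function.iterate_succ_apply]
  simp only [compile, List.append_assoc, List.cons_append, List.nil_append]
  rw [step_of_getElem? (i := Instr.jzero a (pre.length + c.size + 2)) (by simp)]
  have : (Instr.jzero a (pre.length + c.size + 2)).exec x (s.at pre.length) =
      s.at (pre.length + 1) := by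
    simp [Instr.exec, Cfg.at, ha]
  rw [this, Function.iterate_succ_apply', h1,
    step_of_getElem? (i := Instr.jump pre.length)]
  · simp only [Instr.exec, Cfg.at]
  · rw [← length_compile c (pre.length + 1)]
    exact getElem?_append_cons_append_cons ..

theorem Cmd.Runs.loop_pos {x : List ℕ} {c : Cmd} {s s' s'' : Cfg} {t t' a : ℕ}
    (ha : s.mem a ≠ 0) (h : c.Runs x s t s') (h' : (Cmd.loop a c).Runs x s' t' s'') :
    (Cmd.loop a c).Runs x s (t + 2 + t') s'' := by
  intro pre post
  rw [add_comm (t + 2) t', Function.iterate_add_apply, h.loop_body ha, h']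

/-- A loop with a counter that goes down to zero. -/
theorem Cmd.Reach.loop {x : List ℕ} {c : Cmd} {a T : ℕ} {J : ℕ → Cfg → Prop}
    (hJ : ∀ k s, J k s → s.mem a = k) (hc : ∀ k s, J (k + 1) s → c.Reach x s T (J k)) {m : ℕ}
    {s : Cfg} (hs : J m s) : (Cmd.loop a c).Reach x s (m * (T + 2) + 1) (J 0) := by
  induction m generalizing s with
  | zero => exact ⟨1, s, by omega, Runs.loop_zero (hJ 0 s hs), hs⟩
  | succ k ih =>
    obtain ⟨t, s', h1, h2, h3⟩ := hc k s hs
    obtain ⟨t', s'', h4, h5, h6⟩ := ih h3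
    refine ⟨t + 2 + t', s'', ?_, h2.loop_pos ?_ h5, h6⟩
    · have := add_mul k 1 (T + 2)
      omega
    · rw [hJ _ s hs]
      omega

theorem Cmd.Reach.ite {x : List ℕ} {c d : Cmd} {s : Cfg} {a T : ℕ} {Q : Cfg → Prop}
    (hc : s.mem a = 0 → c.Reach x s T Q) (hd : s.mem a ≠ 0 → d.Reach x s T Q) :
    (Cmd.ite a c d).Reach x s (T + 2) Q := by
  by_cases ha : s.mem a = 0
  · obtain ⟨t, s', h1, h2, h3⟩ := hc ha
    exact ⟨t + 1, s', by omega, h2.ite_zero ha, h3⟩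
  · obtain ⟨t, s', h1, h2, h3⟩ := hd ha
    exact ⟨t + 2, s', by omega, h2.ite_pos ha, h3⟩

/-! ### Growth of the memory -/

/-- The memory has at most `k` nonzero registers, with addresses and contents of at most `b` bits. -/
def MemBound (k b : ℕ) (m : ℕ →₀ ℕ) : Prop :=
  m.support.card ≤ k ∧ ∀ a, m a ≠ 0 → Nat.size a ≤ b ∧ Nat.size (m a) ≤ b

theorem MemBound.memSize_le {k b : ℕ} {m : ℕ →₀ ℕ} (h : MemBound k b m) :
    memSize m ≤ k * (2 * b) := by
  unfold memSize Finsupp.sum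
  refine (Finset.sum_le_card_nsmul _ _ (2 * b) fun a ha => ?_).trans ?_
  · have := h.2 a (Finsupp.mem_support_iff.1 ha)
    dsimp only
    omega
  · rw [smul_eq_mul]
    exact Nat.mul_le_mul_right _ h.1

theorem MemBound.mono {k b k' b' : ℕ} {m : ℕ →₀ ℕ} (h : MemBound k b m) (hk : k ≤ k')
    (hb : b ≤ b') : MemBound k' b' m :=
  ⟨h.1.trans hk, fun a ha => ⟨(h.2 a ha).1.trans hb, (h.2 a ha).2.trans hb⟩⟩

theorem MemBound.size_le {k b : ℕ} {m : ℕ →₀ ℕ} (h : MemBound k b m) (a : ℕ) :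
    Nat.size (m a) ≤ b := by
  by_cases ha : m a = 0
  · simp [ha]
  · exact (h.2 a ha).2

theorem MemBound.update {k b d v : ℕ} {m : ℕ →₀ ℕ} (h : MemBound k b m)
    (hd : Nat.size d ≤ b + 1) (hv : Nat.size v ≤ b + 1) :
    MemBound (k + 1) (b + 1) (m.update d v) := by
  classical
  refine ⟨?_, fun a ha => ?_⟩
  · have hsub : (m.update d v).support ⊆ insert d m.support := by
      intro a ha
      rw [Finsupp.mem_support_iff, Finsupp.coe_update, Function.update_apply] at ha
      rw [Finset.mem_insert, Finsupp.mem_support_iff]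
      by_cases had : a = d
      · exact Or.inl had
      · rw [if_neg had] at ha
        exact Or.inr ha
    have := Finset.card_le_card hsub
    have := Finset.card_insert_le d m.support
    have := h.1
    omega
  · rw [Finsupp.coe_update, Function.update_apply] at ha ⊢
    split_ifs at ha ⊢ with had
    · exact ⟨had ▸ hd, hv⟩
    · have := h.2 a ha
      omega

/-- All constants of an instruction have at most `b` bits. -/
def Instr.ConstLe (b : ℕ) : Instr → Prop
  | .imm d k => Nat.size d ≤ b ∧ Nat.size k ≤ b
  | .add d _ _ => Nat.size d ≤ b
  | .sub d _ _ => Nat.size d ≤ b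
  | .read d _ => Nat.size d ≤ b
  | .load d _ => Nat.size d ≤ b
  | _ => True

theorem Instr.ConstLe.mono {b b' : ℕ} {i : Instr} (h : i.ConstLe b) (hb : b ≤ b') :
    i.ConstLe b' := by
  cases i <;> simp_all only [ConstLe] <;> omega

theorem exists_constLe (P : Program) : ∃ b, ∀ i ∈ P, i.ConstLe b := by
  induction P with
  | nil => exact ⟨0, by simp⟩
  | cons i P ih =>
    obtain ⟨b, hb⟩ := ih
    obtain ⟨b', hb'⟩ : ∃ b', i.ConstLe b' := by
      cases i with
      | imm d k => exact ⟨Nat.size d + Nat.size k, by simp [Instr.ConstLe]⟩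
      | add d => exact ⟨Nat.size d, le_rfl⟩
      | sub d => exact ⟨Nat.size d, le_rfl⟩
      | read d => exact ⟨Nat.size d, le_rfl⟩
      | load d => exact ⟨Nat.size d, le_rfl⟩
      | store => exact ⟨0, trivial⟩
      | jump => exact ⟨0, trivial⟩
      | jzero => exact ⟨0, trivial⟩
      | print => exact ⟨0, trivial⟩
      | emit => exact ⟨0, trivial⟩
    refine ⟨b + b', fun j hj => ?_⟩
    rcases List.mem_cons.1 hj with rfl | hj
    · exact hb'.mono (Nat.le_add_left _ _)
    · exact (hb j hj).mono (Nat.le_add_right _ _)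

theorem size_add_le {u v b : ℕ} (hu : Nat.size u ≤ b) (hv : Nat.size v ≤ b) :
    Nat.size (u + v) ≤ b + 1 := by
  rw [Nat.size_le] at *
  rw [pow_succ]
  omega

theorem MemBound.step {P : Program} {x : List ℕ} {c : Cfg} {k b : ℕ} (h : MemBound k b c.mem)
    (hP : ∀ i ∈ P, i.ConstLe b) (hx : ∀ j, Nat.size (x.getD j 0) ≤ b) :
    MemBound (k + 1) (b + 1) (step P x c).mem := by
  have h0 : MemBound (k + 1) (b + 1) c.mem := h.mono (Nat.le_succ _) (Nat.le_succ _)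
  unfold RAM.step
  split
  · next i hi =>
    have hc := hP i (List.mem_of_getElem? hi)
    cases i with
    | imm d v => exact h.update (hc.1.trans (Nat.le_succ _)) (hc.2.trans (Nat.le_succ _))
    | add d u v => exact h.update (hc.trans (Nat.le_succ _)) (size_add_le (h.size_le u) (h.size_le v))
    | sub d u v =>
      exact h.update (hc.trans (Nat.le_succ _))
        (((Nat.size_le_size (Nat.sub_le _ _)).trans (h.size_le u)).trans (Nat.le_succ _))
    | read d u => exact h.update (hc.trans (Nat.le_succ _)) ((hx _).trans (Nat.le_succ _))
    | load d u => exact h.update (hc.trans (Nat.le_succ _)) ((h.size_le _).trans (Nat.le_succ _))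
    | store d u =>
      exact h.update ((h.size_le _).trans (Nat.le_succ _)) ((h.size_le _).trans (Nat.le_succ _))
    | jump => exact h0
    | jzero => exact h0
    | print => exact h0
    | emit => exact h0
  · exact h0

/-- A step fills at most one new register and adds at most one bit. Hence memory need only be
controlled between rounds: during a round it grows by no more than the number of steps. -/
theorem MemBound.iterate_step {P : Program} {x : List ℕ} {c : Cfg} {k b : ℕ}
    (h : MemBound k b c.mem) (hP : ∀ i ∈ P, i.ConstLe b) (hx : ∀ j, Nat.size (x.getD j 0) ≤ b)
    (t : ℕ) : MemBound (k + t) (b + t) ((RAM.step P x)^[t] c).mem := by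
  induction t with
  | zero => exact h
  | succ t ih =>
    rw [Function.iterate_succ_apply']
    exact ih.step (fun i hi => (hP i hi).mono (Nat.le_add_right _ _))
      fun j => (hx j).trans (Nat.le_add_right _ _)

end RAM

/-! ### The enumeration program -/

namespace RAM

/-- `for i = 0, …, n - 1 do c`, where `R[0] = n` and `R[1] = 1`; `R[d]` counts the rounds left. -/
def forCmd (i d : ℕ) (c : Cmd) : Cmd :=
  .seq (.block [.imm i 0, .sub d 0 i]) (.loop d (.seq c (.block [.add i i 1, .sub d 0 i])))

theorem Cmd.Reach.forCmd {x : List ℕ} {c : Cmd} {i d n T : ℕ} {s : Cfg} {J : ℕ → Cfg → Prop}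
    (hJ : ∀ k s, J k s → s.mem d = n - k)
    (h0 : J 0 (((Instr.imm i 0).exec x s).write d
      (((Instr.imm i 0).exec x s).mem 0 - ((Instr.imm i 0).exec x s).mem i)))
    (hc : ∀ k < n, ∀ s, J k s → c.Reach x s T fun s' => J (k + 1)
      ((Instr.sub d 0 i).exec x ((Instr.add i i 1).exec x s'))) :
    (RAM.forCmd i d c).Reach x s (n * (T + 4) + 3) (J n) := by
  refine Reach.mono (T := 2 + (n * (T + 2 + 2) + 1)) (Q := fun s => 0 ≤ n ∧ J (n - 0) s)
    ?_ (by ring_nf; rfl) fun s' h => h.2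
  refine Reach.seq (Reach.block (by simp [Instr.Straight]) ?_)
  refine Reach.loop (J := fun m s => m ≤ n ∧ J (n - m) s) ?_ ?_ ?_
  · rintro k s ⟨h1, h2⟩
    rw [hJ _ _ h2]
    omega
  · rintro k s ⟨h1, h2⟩
    refine Reach.seq ((hc _ (by omega) s h2).mono le_rfl fun s' h => ?_)
    refine Reach.block (by simp [Instr.Straight]) ⟨by omega, ?_⟩
    rwa [show n - (k + 1) + 1 = n - k by omega] at h
  · refine ⟨le_rfl, ?_⟩
    rw [Nat.sub_self]
    exact h0

/-- `R[10] :=` the number of neighbours in the current set of the vertex whose row starts at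
position `R[9]` of the input; `R[9]` is moved to the next row. -/
def countCmd : Cmd :=
  .seq (.block [.imm 10 0]) (forCmd 3 4 (.block [.imm 11 16, .add 11 11 3, .load 11 11,
    .sub 11 1 11, .read 12 9, .sub 12 12 11, .add 10 10 12, .add 9 9 1]))

/-- `R[13] :=` the number of private neighbours of the vertex `R[7]`. -/
def privCmd : Cmd :=
  .seq (.block [.imm 13 0, .imm 9 1]) (forCmd 5 6
    -- `R[9]` is the start of row `u`, so `R[9] + R[7]` is the position of the entry for `u` and
    -- `v`. Then `countCmd` advances `R[9]` by `n`, which spares a multiplication.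
    (.seq (.block [.add 15 9 7, .read 15 15, .sub 15 1 15]) (.seq countCmd
      (.block [.imm 11 16, .add 11 11 5, .load 11 11, .add 15 15 11, .sub 10 10 1,
        .add 15 15 10, .sub 15 1 15, .add 13 13 15]))))

/-- `R[14] :=` the number of members of the current set without private neighbours. -/
def badCmd : Cmd :=
  .seq (.block [.imm 14 0]) (forCmd 7 8 (.seq privCmd
    (.block [.imm 11 16, .add 11 11 7, .load 11 11, .sub 11 11 13, .add 14 14 11])))

/-- Print the function that belongs to the current set. -/
def printCmd : Cmd :=
  .seq (.block [.imm 9 1]) (forCmd 5 6 (.seq countCmd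
    (.block [.imm 11 16, .add 11 11 5, .load 11 11, .add 15 11 11, .sub 11 1 11, .sub 11 11 10,
      .add 15 15 11, .print 15])))

/-- Set the auxiliary registers to zero. -/
def clearCmd : Cmd :=
  .block [.imm 3 0, .imm 4 0, .imm 5 0, .imm 6 0, .imm 7 0, .imm 8 0, .imm 9 0, .imm 10 0,
    .imm 11 0, .imm 12 0, .imm 13 0, .imm 14 0, .imm 15 0]

/-- Remove the vertex `R[2]` from the current set. -/
def removeCmd : Cmd := .block [.imm 11 16, .add 11 11 2, .imm 12 0, .store 11 12]

/-- Deliver the printed word and set `R[2] := n`. -/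
def deliverCmd : Cmd := .block [.emit, .imm 2 0, .add 2 2 0]

/-- One round of the search: decrease `R[2]`; if this vertex is in the current set, remove it,
and otherwise add it if the set stays open irredundant. -/
def bodyCmd : Cmd :=
  .seq (.block [.sub 2 2 1, .imm 11 16, .add 11 11 2, .load 12 11])
    -- Resetting the pointer to `n` after a delivery enters the subtree of the enlarged set; when
    -- the pointer meets a member, the subtree of the current set is exhausted.
    (.seq (.ite 12 (.seq (.block [.store 11 1]) (.seq badCmd
      (.ite 14 (.seq printCmd deliverCmd) removeCmd))) removeCmd) clearCmd)

/-- The output for the empty set, and the preparation of the search. -/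
def initCmd : Cmd :=
  .seq (.block [.imm 1 1, .read 0 0]) (.seq printCmd (.seq deliverCmd clearCmd))

/-- The enumeration of the open irredundant sets. -/
def mainCmd : Cmd := .seq initCmd (.loop 2 bodyCmd)

/-! ### The values that the program computes -/

/-- The indicator function of `A`. -/
def ind (A : Finset ℕ) (w : ℕ) : ℕ := if w ∈ A then 1 else 0

/-- The number of neighbours in `A` of the vertex whose row starts at `p`. -/
def nbrCount (x : List ℕ) (A : Finset ℕ) (p k : ℕ) : ℕ :=
  -- For bits, the truncated difference `a - (1 - b)` is the product `a * b`.
  ∑ w ∈ Finset.range k, (x.getD (p + w) 0 - (1 - ind A w))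

/-- The number of private neighbours of `v`. -/
def privCount (x : List ℕ) (n : ℕ) (A : Finset ℕ) (v k : ℕ) : ℕ :=
  -- The summand is 1 exactly if three defects vanish: `u` not adjacent to `v`, `u` in `A`, more
  -- than one neighbour of `u` in `A`.
  ∑ u ∈ Finset.range k, (1 - (1 - x.getD (1 + u * n + v) 0 + ind A u +
    (nbrCount x A (1 + u * n) n - 1)))

/-- The number of members of `A` without private neighbours. -/
def badCount (x : List ℕ) (n : ℕ) (A : Finset ℕ) (k : ℕ) : ℕ :=
  ∑ v ∈ Finset.range k, (ind A v - privCount x n A v n)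

/-- The value at `u` of the function that belongs to `A`. -/
def outVal (x : List ℕ) (n : ℕ) (A : Finset ℕ) (u : ℕ) : ℕ :=
  ind A u + ind A u + (1 - ind A u - nbrCount x A (1 + u * n) n)

/-- The output word for `A`. -/
def outWord (x : List ℕ) (n : ℕ) (A : Finset ℕ) : List ℕ := (List.range n).map (outVal x n A)

/-! ### Correctness of the parts -/

/-- The memories agree outside the registers in `l`. -/
def SameMem (l : List ℕ) (s s' : Cfg) : Prop := ∀ a, a ∉ l → s'.mem a = s.mem a

/-- The memory holds `n`, the constant `1`, the position `i` and the set `A`. -/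
structure Frame (n i : ℕ) (A : Finset ℕ) (s : Cfg) : Prop where
  zero : s.mem 0 = n
  one : s.mem 1 = 1
  two : s.mem 2 = i
  arr : ∀ w, s.mem (16 + w) = ind A w

theorem SameMem.frame {l : List ℕ} {s s' : Cfg} {n i : ℕ} {A : Finset ℕ} (h : SameMem l s s')
    (hs : Frame n i A s) (hl : ∀ a ∈ l, 3 ≤ a ∧ a < 16) : Frame n i A s' := by
  have h' : ∀ a, (a < 3 ∨ 16 ≤ a) → s'.mem a = s.mem a := fun a ha => h a fun hal => by
    have := hl a hal
    omega
  exact ⟨by rw [h' 0 (by omega), hs.zero], by rw [h' 1 (by omega), hs.one],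
    by rw [h' 2 (by omega), hs.two], fun w => by rw [h' _ (by omega), hs.arr]⟩

theorem countCmd_reach {x : List ℕ} {n i p : ℕ} {A : Finset ℕ} {s : Cfg} (hs : Frame n i A s)
    (hp : s.mem 9 = p) :
    countCmd.Reach x s (12 * n + 4) fun s' => SameMem [3, 4, 9, 10, 11, 12] s s' ∧
      s'.word = s.word ∧ s'.outs = s.outs ∧ s'.mem 9 = p + n ∧
      s'.mem 10 = nbrCount x A p n := by
  have h0 := hs.zero
  have h1 := hs.one
  refine Cmd.Reach.mono (T := 1 + (n * (8 + 4) + 3)) ?_ (by omega) fun s' h => h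
  refine Cmd.Reach.seq (Cmd.Reach.block (by simp [Instr.Straight]) ?_)
  refine (Cmd.Reach.forCmd (n := n) (J := fun k s' => s'.mem 4 = n - k ∧ s'.mem 3 = k ∧
    SameMem [3, 4, 9, 10, 11, 12] s s' ∧
      s'.word = s.word ∧ s'.outs = s.outs ∧ s'.mem 9 = p + k ∧
      s'.mem 10 = nbrCount x A p k) (fun k s h => h.1) ?_ ?_).mono le_rfl fun s' h => h.2.2
  · refine ⟨?_, ?_, fun a ha => ?_, ?_, ?_, ?_, ?_⟩
    all_goals try simp only [List.mem_cons, List.not_mem_nil, or_false, not_or] at ha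
    all_goals simp_all [Instr.exec, Cfg.write, nbrCount]
  · rintro k hk s' ⟨h4, h3, hsame, hword, houts, h9, h10⟩
    have hf := hsame.frame hs (by simp)
    have h0' := hf.zero
    have h1' := hf.one
    have harr := hf.arr k
    have h16 : 16 + k ≠ 11 := by omega
    refine Cmd.Reach.block (by simp [Instr.Straight]) ⟨?_, ?_, fun a ha => ?_, ?_, ?_, ?_, ?_⟩
    · simp [Instr.exec, Cfg.write, Function.update_apply, h3, h0', h1']
    · simp [Instr.exec, Cfg.write, Function.update_apply, h3, h0', h1']
    · have := hsame a ha
      simp only [List.mem_cons, List.not_mem_nil, or_false, not_or] at ha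
      simp [Instr.exec, Cfg.write, Function.update_apply, ha, this]
    · simpa [Instr.exec, Cfg.write] using hword
    · simpa [Instr.exec, Cfg.write] using houts
    · simp [Instr.exec, Cfg.write, Function.update_apply, h9, h1', add_assoc]
    · simp [Instr.exec, Cfg.write, h3, h1', h9, h10, harr, h16, nbrCount,
        Finset.sum_range_succ]

theorem privCmd_reach {x : List ℕ} {n i v : ℕ} {A : Finset ℕ} {s : Cfg} (hs : Frame n i A s)
    (hv : s.mem 7 = v) :
    privCmd.Reach x s (2 + (n * (12 * n + 19) + 3)) fun s' =>
      SameMem [3, 4, 5, 6, 9, 10, 11, 12, 13, 15] s s' ∧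
      s'.word = s.word ∧ s'.outs = s.outs ∧ s'.mem 13 = privCount x n A v n := by
  have h0 := hs.zero
  have h1 := hs.one
  refine Cmd.Reach.seq (Cmd.Reach.block (by simp [Instr.Straight]) ?_)
  refine (Cmd.Reach.forCmd (n := n) (T := 12 * n + 15) (J := fun k s' => s'.mem 6 = n - k ∧
    s'.mem 5 = k ∧ s'.mem 9 = 1 + k * n ∧ SameMem [3, 4, 5, 6, 9, 10, 11, 12, 13, 15] s s' ∧
      s'.word = s.word ∧ s'.outs = s.outs ∧
      s'.mem 13 = privCount x n A v k) (fun k s h => h.1) ?_ ?_).mono le_rfl fun s' h => h.2.2.2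
  · refine ⟨?_, ?_, ?_, fun a ha => ?_, ?_, ?_, ?_⟩
    all_goals try simp only [List.mem_cons, List.not_mem_nil, or_false, not_or] at ha
    all_goals simp_all [Instr.exec, Cfg.write, privCount]
  · rintro k hk s' ⟨h6, h5, h9, hsame, hword, houts, h13⟩
    have hf := hsame.frame hs (by simp)
    have h0' := hf.zero
    have h1' := hf.one
    have h7 : s'.mem 7 = v := (hsame 7 (by simp)).trans hv
    refine Cmd.Reach.mono (T := 3 + (12 * n + 4 + 8)) ?_ (by omega) fun s' h => h
    refine Cmd.Reach.seq (Cmd.Reach.block (by simp [Instr.Straight]) ?_)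
    set s₁ := List.foldl (fun s i => Instr.exec x s i) s' _ with hs₁
    have hsame₁ : SameMem [15] s' s₁ := fun a ha => by
      simp only [List.mem_cons, List.not_mem_nil, or_false] at ha
      simp [hs₁, Instr.exec, Cfg.write, ha]
    have h15 : s₁.mem 15 = 1 - x.getD (1 + k * n + v) 0 := by
      simp [hs₁, Instr.exec, Cfg.write, h9, h7, h1']
    have hf₁ := hsame₁.frame hf (by simp)
    refine Cmd.Reach.seq ((countCmd_reach hf₁ ((hsame₁ 9 (by simp)).trans h9)).mono le_rfl ?_)
    rintro s₂ ⟨hsame₂, hword₂, houts₂, h9₂, h10₂⟩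
    have hf₂ := hsame₂.frame hf₁ (by simp)
    have h0₂ := hf₂.zero
    have h1₂ := hf₂.one
    have harr := hf₂.arr k
    have h15₂ := (hsame₂ 15 (by simp)).trans h15
    have h5₂ := ((hsame₂ 5 (by simp)).trans (hsame₁ 5 (by simp))).trans h5
    have h13₂ := ((hsame₂ 13 (by simp)).trans (hsame₁ 13 (by simp))).trans h13
    have h16 : ∀ a < 16, 16 + k ≠ a := fun a ha => by omega
    refine Cmd.Reach.block (by simp [Instr.Straight]) ⟨?_, ?_, ?_, fun a ha => ?_, ?_, ?_, ?_⟩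
    · simp [Instr.exec, Cfg.write, Function.update_apply, h5₂, h0₂, h1₂]
    · simp [Instr.exec, Cfg.write, Function.update_apply, h5₂, h1₂]
    · simp [Instr.exec, Cfg.write, Function.update_apply, h9₂]
      ring
    · have e := hsame a ha
      simp only [List.mem_cons, List.not_mem_nil, or_false, not_or] at ha
      have e₁ := hsame₁ a (by simp [ha])
      have e₂ := hsame₂ a (by simp [ha])
      simp [Instr.exec, Cfg.write, ha, e, e₁, e₂]
    · simpa [Instr.exec, Cfg.write, hword₂, hs₁] using hword
    · simpa [Instr.exec, Cfg.write, houts₂, hs₁] using houts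
    · simp [Instr.exec, Cfg.write, h5₂, h1₂, h10₂, harr, h16, h15₂, h13₂,
        privCount, Finset.sum_range_succ]

theorem badCmd_reach {x : List ℕ} {n i : ℕ} {A : Finset ℕ} {s : Cfg} (hs : Frame n i A s) :
    badCmd.Reach x s (1 + (n * ((2 + (n * (12 * n + 19) + 3)) + 5 + 4) + 3)) fun s' =>
      SameMem [3, 4, 5, 6, 7, 8, 9, 10, 11, 12, 13, 14, 15] s s' ∧
      s'.word = s.word ∧ s'.outs = s.outs ∧ s'.mem 14 = badCount x n A n := by
  have h0 := hs.zero
  have h1 := hs.one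
  refine Cmd.Reach.seq (Cmd.Reach.block (by simp [Instr.Straight]) ?_)
  refine (Cmd.Reach.forCmd (n := n) (J := fun k s' => s'.mem 8 = n - k ∧
    s'.mem 7 = k ∧ SameMem [3, 4, 5, 6, 7, 8, 9, 10, 11, 12, 13, 14, 15] s s' ∧
      s'.word = s.word ∧ s'.outs = s.outs ∧
      s'.mem 14 = badCount x n A k) (fun k s h => h.1) ?_ ?_).mono le_rfl fun s' h => h.2.2
  · refine ⟨?_, ?_, fun a ha => ?_, ?_, ?_, ?_⟩
    all_goals try simp only [List.mem_cons, List.not_mem_nil, or_false, not_or] at ha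
    all_goals simp_all [Instr.exec, Cfg.write, badCount]
  · rintro k hk s' ⟨h8, h7, hsame, hword, houts, h14⟩
    have hf := hsame.frame hs (by simp)
    refine Cmd.Reach.seq ((privCmd_reach hf h7).mono le_rfl ?_)
    rintro s₂ ⟨hsame₂, hword₂, houts₂, h13₂⟩
    have hf₂ := hsame₂.frame hf (by simp)
    have h0₂ := hf₂.zero
    have h1₂ := hf₂.one
    have harr := hf₂.arr k
    have h7₂ := (hsame₂ 7 (by simp)).trans h7
    have h14₂ := (hsame₂ 14 (by simp)).trans h14
    have h16 : ∀ a < 16, 16 + k ≠ a := fun a ha => by omega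
    refine Cmd.Reach.block (by simp [Instr.Straight]) ⟨?_, ?_, fun a ha => ?_, ?_, ?_, ?_⟩
    · simp [Instr.exec, Cfg.write, Function.update_apply, h7₂, h0₂, h1₂]
    · simp [Instr.exec, Cfg.write, Function.update_apply, h7₂, h1₂]
    · have e := hsame a ha
      simp only [List.mem_cons, List.not_mem_nil, or_false, not_or] at ha
      have e₂ := hsame₂ a (by simp [ha])
      simp [Instr.exec, Cfg.write, ha, e, e₂]
    · simpa [Instr.exec, Cfg.write, hword₂] using hword
    · simpa [Instr.exec, Cfg.write, houts₂] using houts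
    · simp [Instr.exec, Cfg.write, h7₂, harr, h16, h13₂, h14₂,
        badCount, Finset.sum_range_succ]

theorem printCmd_reach {x : List ℕ} {n i : ℕ} {A : Finset ℕ} {s : Cfg} (hs : Frame n i A s) :
    printCmd.Reach x s (1 + (n * (12 * n + 4 + 8 + 4) + 3)) fun s' =>
      SameMem [3, 4, 5, 6, 9, 10, 11, 12, 15] s s' ∧
      s'.word = s.word ++ outWord x n A ∧ s'.outs = s.outs := by
  have h0 := hs.zero
  have h1 := hs.one
  refine Cmd.Reach.seq (Cmd.Reach.block (by simp [Instr.Straight]) ?_)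
  refine (Cmd.Reach.forCmd (n := n) (T := 12 * n + 4 + 8) (J := fun k s' => s'.mem 6 = n - k ∧
    s'.mem 5 = k ∧ s'.mem 9 = 1 + k * n ∧ SameMem [3, 4, 5, 6, 9, 10, 11, 12, 15] s s' ∧
      s'.word = s.word ++ (List.range k).map (outVal x n A) ∧ s'.outs = s.outs)
      (fun k s h => h.1) ?_ ?_).mono le_rfl fun s' h => h.2.2.2
  · refine ⟨?_, ?_, ?_, fun a ha => ?_, ?_, ?_⟩
    all_goals try simp only [List.mem_cons, List.not_mem_nil, or_false, not_or] at ha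
    all_goals simp_all [Instr.exec, Cfg.write]
  · rintro k hk s' ⟨h6, h5, h9, hsame, hword, houts⟩
    have hf := hsame.frame hs (by simp)
    refine Cmd.Reach.seq ((countCmd_reach hf h9).mono le_rfl ?_)
    rintro s₂ ⟨hsame₂, hword₂, houts₂, h9₂, h10₂⟩
    have hf₂ := hsame₂.frame hf (by simp)
    have h0₂ := hf₂.zero
    have h1₂ := hf₂.one
    have harr := hf₂.arr k
    have h5₂ := (hsame₂ 5 (by simp)).trans h5
    have h16 : ∀ a < 16, 16 + k ≠ a := fun a ha => by omega
    refine Cmd.Reach.block (by simp [Instr.Straight]) ⟨?_, ?_, ?_, fun a ha => ?_, ?_, ?_⟩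
    · simp [Instr.exec, Cfg.write, Function.update_apply, h5₂, h0₂, h1₂]
    · simp [Instr.exec, Cfg.write, Function.update_apply, h5₂, h1₂]
    · simp [Instr.exec, Cfg.write, Function.update_apply, h9₂]
      ring
    · have e := hsame a ha
      simp only [List.mem_cons, List.not_mem_nil, or_false, not_or] at ha
      have e₂ := hsame₂ a (by simp [ha])
      simp [Instr.exec, Cfg.write, ha, e, e₂]
    · simp [Instr.exec, Cfg.write, h5₂, h1₂, h10₂, harr, h16, hword₂, hword,
        List.range_succ, outVal]
    · simpa [Instr.exec, Cfg.write, houts₂] using houts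

/-! ### Correctness of a round -/

/-- The configurations between two rounds. -/
structure Ready (n i : ℕ) (A : Finset ℕ) (s : Cfg) : Prop extends Frame n i A s where
  clear : ∀ a, 3 ≤ a → a < 16 → s.mem a = 0
  word : s.word = []

theorem clearCmd_reach {x : List ℕ} {n i : ℕ} {A : Finset ℕ} {s : Cfg} (hs : Frame n i A s)
    (hword : s.word = []) :
    clearCmd.Reach x s 13 fun s' => Ready n i A s' ∧ s'.outs = s.outs := by
  have h0 := hs.zero
  have h1 := hs.one
  have h2 := hs.two
  have h16 : ∀ w, ∀ a < 16, 16 + w ≠ a := fun w a ha => by omega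
  refine Cmd.Reach.block (by simp [Instr.Straight]) ⟨⟨⟨?_, ?_, ?_, fun w => ?_⟩, ?_, ?_⟩, ?_⟩
  · simpa [Instr.exec, Cfg.write] using h0
  · simpa [Instr.exec, Cfg.write] using h1
  · simpa [Instr.exec, Cfg.write] using h2
  · simpa [Instr.exec, Cfg.write, h16] using hs.arr w
  · intro a ha ha'
    interval_cases a <;> simp [Instr.exec, Cfg.write]
  · simpa [Instr.exec, Cfg.write] using hword
  · simp [Instr.exec, Cfg.write]

theorem deliverCmd_reach {x : List ℕ} {n i : ℕ} {A : Finset ℕ} {s : Cfg} (hs : Frame n i A s) :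
    deliverCmd.Reach x s 3 fun s' => Frame n n A s' ∧ s'.word = [] ∧
      s'.outs = s.outs ++ [s.word] := by
  have h0 := hs.zero
  have h1 := hs.one
  have h16 : ∀ w, ∀ a < 16, 16 + w ≠ a := fun w a ha => by omega
  refine Cmd.Reach.block (by simp [Instr.Straight]) ⟨⟨?_, ?_, ?_, fun w => ?_⟩, ?_, ?_⟩
  · simpa [Instr.exec, Cfg.write] using h0
  · simpa [Instr.exec, Cfg.write] using h1
  · simpa [Instr.exec, Cfg.write] using h0
  · simpa [Instr.exec, Cfg.write, h16] using hs.arr w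
  · simp [Instr.exec, Cfg.write]
  · simp [Instr.exec, Cfg.write]

theorem removeCmd_reach {x : List ℕ} {n i : ℕ} {A : Finset ℕ} {s : Cfg} (hs : Frame n i A s) :
    removeCmd.Reach x s 4 fun s' => Frame n i (A.erase i) s' ∧ s'.word = s.word ∧
      s'.outs = s.outs := by
  have h0 := hs.zero
  have h1 := hs.one
  have h2 := hs.two
  have h16 : ∀ w, ∀ a < 16, 16 + w ≠ a := fun w a ha => by omega
  have h16' : ∀ w, ∀ a < 16, a ≠ 16 + w := fun w a ha => by omega
  refine Cmd.Reach.block (by simp [Instr.Straight]) ⟨⟨?_, ?_, ?_, fun w => ?_⟩, ?_, ?_⟩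
  · simpa [Instr.exec, Cfg.write, Function.update_apply, h2, h16'] using h0
  · simpa [Instr.exec, Cfg.write, Function.update_apply, h2, h16'] using h1
  · simp [Instr.exec, Cfg.write, h2, h16']
  · have := hs.arr w
    by_cases hw : w = i <;>
      simp [Instr.exec, Cfg.write, h2, h16, ind, hw, this]
  · simp [Instr.exec, Cfg.write]
  · simp [Instr.exec, Cfg.write]

/-- A bound for the number of steps of a round. -/
def roundTime (n : ℕ) : ℕ := 100 * (n + 1) ^ 3

/-- The effect of a round. -/
def RoundPost (x : List ℕ) (n i : ℕ) (A : Finset ℕ) (s s' : Cfg) : Prop :=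
  if i ∈ A then Ready n i (A.erase i) s' ∧ s'.outs = s.outs
  else if badCount x n (insert i A) n = 0 then
    Ready n n (insert i A) s' ∧ s'.outs = s.outs ++ [outWord x n (insert i A)]
  else Ready n i A s' ∧ s'.outs = s.outs

theorem bodyCmd_reach {x : List ℕ} {n i : ℕ} {A : Finset ℕ} {s : Cfg}
    (hs : Ready n (i + 1) A s) : bodyCmd.Reach x s (roundTime n) (RoundPost x n i A s) := by
  have h16 : ∀ w, ∀ a < 16, 16 + w ≠ a := fun w a ha => by omega
  have h16' : ∀ w, ∀ a < 16, a ≠ 16 + w := fun w a ha => by omega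
  have h0 := hs.zero
  have h1 := hs.one
  have h2 := hs.two
  refine Cmd.Reach.mono (T := 4 + ((1 + ((1 + (n * ((2 + (n * (12 * n + 19) + 3)) + 5 + 4) + 3)) +
    ((1 + (n * (12 * n + 4 + 8 + 4) + 3) + 3) + 2)) + 2) + 13)) ?_ ?_ fun s' h => h
  swap
  · unfold roundTime
    ring_nf
    nlinarith
  refine Cmd.Reach.seq (Cmd.Reach.block (by simp [Instr.Straight]) ?_)
  set s₁ := List.foldl (fun s i => Instr.exec x s i) s _ with hs₁
  have hf₁ : Frame n i A s₁ := by
    refine ⟨?_, ?_, ?_, fun w => ?_⟩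
    · simpa [hs₁, Instr.exec, Cfg.write] using h0
    · simpa [hs₁, Instr.exec, Cfg.write] using h1
    · simp [hs₁, Instr.exec, Cfg.write, h1, h2]
    · simpa [hs₁, Instr.exec, Cfg.write, h16] using hs.arr w
  have h11 : s₁.mem 11 = 16 + i := by
    simp [hs₁, Instr.exec, Cfg.write, Function.update_apply, h1, h2]
  have h12 : s₁.mem 12 = ind A i := by
    simpa [hs₁, Instr.exec, Cfg.write, Function.update_apply, h1, h2, h16] using hs.arr i
  have hw₁ : s₁.word = [] := by simpa [hs₁, Instr.exec, Cfg.write] using hs.word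
  have ho₁ : s₁.outs = s.outs := by simp [hs₁, Instr.exec, Cfg.write]
  clear_value s₁
  refine Cmd.Reach.seq (Cmd.Reach.ite (fun hz => ?_) fun hz => ?_)
  · have hiA : i ∉ A := by
      rw [h12] at hz
      simpa [ind] using hz
    refine Cmd.Reach.seq (Cmd.Reach.block (by simp [Instr.Straight]) ?_)
    set s₂ := List.foldl (fun s i => Instr.exec x s i) s₁ _ with hs₂
    have hf₂ : Frame n i (insert i A) s₂ := by
      refine ⟨?_, ?_, ?_, fun w => ?_⟩
      · simpa [hs₂, Instr.exec, Cfg.write, h11, h16, h16'] using hf₁.zero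
      · simpa [hs₂, Instr.exec, Cfg.write, h11, h16, h16'] using hf₁.one
      · simpa [hs₂, Instr.exec, Cfg.write, h11, h16, h16'] using hf₁.two
      · have := hf₁.arr w
        by_cases hw : w = i <;>
          simp [hs₂, Instr.exec, Cfg.write, h11, hf₁.one, ind, hw, this]
    have hw₂ : s₂.word = [] := by simpa [hs₂, Instr.exec, Cfg.write] using hw₁
    have ho₂ : s₂.outs = s.outs := by simpa [hs₂, Instr.exec, Cfg.write] using ho₁
    clear_value s₂
    refine Cmd.Reach.seq ((badCmd_reach hf₂).mono le_rfl ?_)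
    rintro s₃ ⟨hsame₃, hw₃, ho₃, h14⟩
    have hf₃ := hsame₃.frame hf₂ (by simp)
    refine Cmd.Reach.ite (fun hb => ?_) fun hb => ?_
    · refine Cmd.Reach.seq ((printCmd_reach hf₃).mono le_rfl ?_)
      rintro s₄ ⟨hsame₄, hw₄, ho₄⟩
      refine (deliverCmd_reach (hsame₄.frame hf₃ (by simp))).mono le_rfl ?_
      rintro s₅ ⟨hf₅, hw₅, ho₅⟩
      refine (clearCmd_reach hf₅ hw₅).mono le_rfl ?_
      rintro s₆ ⟨h6, ho₆⟩
      rw [h14] at hb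
      rw [RoundPost, if_neg hiA, if_pos hb]
      refine ⟨h6, ?_⟩
      rw [ho₆, ho₅, ho₄, ho₃, ho₂, hw₄, hw₃, hw₂, List.nil_append]
    · refine (removeCmd_reach hf₃).mono (by omega) ?_
      rintro s₅ ⟨hf₅, hw₅, ho₅⟩
      rw [Finset.erase_insert hiA] at hf₅
      refine (clearCmd_reach hf₅ (by rw [hw₅, hw₃, hw₂])).mono le_rfl ?_
      rintro s₆ ⟨h6, ho₆⟩
      rw [h14] at hb
      rw [RoundPost, if_neg hiA, if_neg hb]
      exact ⟨h6, by rw [ho₆, ho₅, ho₃, ho₂]⟩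
  · have hiA : i ∈ A := by
      rw [h12] at hz
      simpa [ind] using hz
    refine (removeCmd_reach hf₁).mono (by omega) ?_
    rintro s₅ ⟨hf₅, hw₅, ho₅⟩
    refine (clearCmd_reach hf₅ (by rw [hw₅, hw₁])).mono le_rfl ?_
    rintro s₆ ⟨h6, ho₆⟩
    rw [RoundPost, if_pos hiA]
    exact ⟨h6, by rw [ho₆, ho₅, ho₁]⟩

theorem initCmd_reach {x : List ℕ} {n : ℕ} (hx : x.getD 0 0 = n) :
    initCmd.Reach x ⟨0, 0, [], []⟩ (roundTime n) fun s' =>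
      Ready n n ∅ s' ∧ s'.outs = [outWord x n ∅] := by
  refine Cmd.Reach.mono (T := 2 + (1 + (n * (12 * n + 4 + 8 + 4) + 3) + (3 + 13))) ?_ ?_
    fun s' h => h
  swap
  · unfold roundTime
    ring_nf
    nlinarith
  refine Cmd.Reach.seq (Cmd.Reach.block (by simp [Instr.Straight]) ?_)
  set s₁ := List.foldl (fun s i => Instr.exec x s i) _ _ with hs₁
  have hf₁ : Frame n 0 ∅ s₁ := by
    refine ⟨?_, ?_, ?_, fun w => ?_⟩
    · simpa [hs₁, Instr.exec, Cfg.write] using hx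
    · simp [hs₁, Instr.exec, Cfg.write]
    · simp [hs₁, Instr.exec, Cfg.write]
    · have : 16 + w ≠ 1 := by omega
      simp [hs₁, Instr.exec, Cfg.write, ind, this]
  have hw₁ : s₁.word = [] := by simp [hs₁, Instr.exec, Cfg.write]
  have ho₁ : s₁.outs = [] := by simp [hs₁, Instr.exec, Cfg.write]
  clear_value s₁
  refine Cmd.Reach.seq ((printCmd_reach hf₁).mono le_rfl ?_)
  rintro s₄ ⟨hsame₄, hw₄, ho₄⟩
  refine Cmd.Reach.seq ((deliverCmd_reach (hsame₄.frame hf₁ (by simp))).mono le_rfl ?_)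
  rintro s₅ ⟨hf₅, hw₅, ho₅⟩
  refine (clearCmd_reach hf₅ hw₅).mono le_rfl ?_
  rintro s₆ ⟨h6, ho₆⟩
  refine ⟨h6, ?_⟩
  rw [ho₆, ho₅, ho₄, ho₁, hw₄, hw₁, List.nil_append, List.nil_append]

end RAM

/-! ### The search tree -/

open Classical in
/-- The sets with property `F` that arise from `A` by adding some of the last `d` vertices, other
than `A` itself, in the order of the search. -/
noncomputable def searchList (F : Finset ℕ → Prop) (n : ℕ) : ℕ → Finset ℕ → List (Finset ℕ)
  | 0, _ => []
  | d + 1, A => searchList F n d A ++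
      if F (insert (n - (d + 1)) A) then
        insert (n - (d + 1)) A :: searchList F n d (insert (n - (d + 1)) A)
      else []

-- The cases `i ∉ B` and `i ∈ B` are the two branches. Pruning loses nothing: every `B` below the
-- second branch contains `insert i A`, so `F B` would imply `F (insert i A)`.
open Classical in
theorem mem_searchList {F : Finset ℕ → Prop} {n : ℕ} (hF : ∀ A B, A ⊆ B → F B → F A) (d : ℕ) :
    ∀ (i : ℕ) (A : Finset ℕ), i + d = n → A ⊆ Finset.range i → ∀ B,
      B ∈ searchList F n d A ↔ F B ∧ B ⊆ Finset.range n ∧ B ≠ A ∧ ∀ w < i, w ∈ B ↔ w ∈ A := by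
  induction d with
  | zero =>
    intro i A hi hA B
    simp only [searchList, List.not_mem_nil, false_iff]
    rintro ⟨-, h1, h2, h3⟩
    apply h2
    ext w
    by_cases hw : w < i
    · exact h3 w hw
    · refine iff_of_false (fun h => ?_) fun h => hw (Finset.mem_range.1 (hA h))
      have := Finset.mem_range.1 (h1 h)
      omega
  | succ d ih =>
    intro i A hi hA B
    have hid : n - (d + 1) = i := by omega
    have hiA : i ∉ A := fun h => by simpa using hA h
    have hA1 : A ⊆ Finset.range (i + 1) := hA.trans (Finset.range_subset_range.2 (by omega))
    have hA2 : insert i A ⊆ Finset.range (i + 1) := by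
      rw [Finset.insert_subset_iff]
      exact ⟨by simp, hA1⟩
    rw [searchList, List.mem_append, hid, ih (i + 1) A (by omega) hA1]
    have hlt : (∀ w < i + 1, w ∈ B ↔ w ∈ A) ↔ i ∉ B ∧ ∀ w < i, w ∈ B ↔ w ∈ A := by
      constructor
      · intro h
        exact ⟨fun hB => hiA ((h i (by omega)).1 hB), fun w hw => h w (by omega)⟩
      · rintro ⟨h1, h2⟩ w hw
        rcases Nat.lt_succ_iff_lt_or_eq.1 hw with h | rfl
        · exact h2 w h
        · exact iff_of_false h1 hiA
    have hlt' : (∀ w < i + 1, w ∈ B ↔ w ∈ insert i A) ↔ i ∈ B ∧ ∀ w < i, w ∈ B ↔ w ∈ A := by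
      constructor
      · intro h
        refine ⟨(h i (by omega)).2 (by simp), fun w hw => ?_⟩
        rw [h w (by omega), Finset.mem_insert]
        simp [hw.ne]
      · rintro ⟨h1, h2⟩ w hw
        rcases Nat.lt_succ_iff_lt_or_eq.1 hw with h | rfl
        · rw [h2 w h, Finset.mem_insert]
          simp [h.ne]
        · exact iff_of_true h1 (by simp)
    have hsub : i ∈ B → (∀ w < i, w ∈ B ↔ w ∈ A) → insert i A ⊆ B := by
      intro h1 h2
      rw [Finset.insert_subset_iff]
      exact ⟨h1, fun w hw => (h2 w (Finset.mem_range.1 (hA hw))).2 hw⟩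
    have key : (B ∈ (if F (insert i A) then insert i A :: searchList F n d (insert i A) else [])) ↔
        F B ∧ B ⊆ Finset.range n ∧ i ∈ B ∧ ∀ w < i, w ∈ B ↔ w ∈ A := by
      split_ifs with hf
      · rw [List.mem_cons, ih (i + 1) _ (by omega) hA2, hlt']
        constructor
        · rintro (rfl | ⟨h1, h2, -, h3⟩)
          · refine ⟨hf, hA2.trans (Finset.range_subset_range.2 (by omega)), by simp, ?_⟩
            intro w hw
            rw [Finset.mem_insert]
            simp [hw.ne]
          · exact ⟨h1, h2, h3⟩
        · rintro ⟨h1, h2, h3⟩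
          by_cases h : B = insert i A
          · exact Or.inl h
          · exact Or.inr ⟨h1, h2, h, h3⟩
      · simp only [List.not_mem_nil, false_iff]
        rintro ⟨h1, -, h2, h3⟩
        exact hf (hF _ _ (hsub h2 h3) h1)
    rw [key, hlt]
    constructor
    · rintro (⟨h1, h2, h3, h4, h5⟩ | ⟨h1, h2, h3, h4⟩)
      · exact ⟨h1, h2, h3, h5⟩
      · refine ⟨h1, h2, ?_, h4⟩
        rintro rfl
        exact hiA h3
    · rintro ⟨h1, h2, h3, h4⟩
      by_cases h : i ∈ B
      · exact Or.inr ⟨h1, h2, h, h4⟩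
      · exact Or.inl ⟨h1, h2, h3, h, h4⟩

/-- The two branches are disjoint, because the vertex `i` lies in all sets of the second and in none
of the first. -/
theorem nodup_searchList {F : Finset ℕ → Prop} {n : ℕ} (hF : ∀ A B, A ⊆ B → F B → F A) (d : ℕ) :
    ∀ (i : ℕ) (A : Finset ℕ), i + d = n → A ⊆ Finset.range i → (searchList F n d A).Nodup := by
  induction d with
  | zero => exact fun i A _ _ => List.nodup_nil
  | succ d ih =>
    intro i A hi hA
    have hid : n - (d + 1) = i := by omega
    have hiA : i ∉ A := fun h => by simpa using hA h
    have hA1 : A ⊆ Finset.range (i + 1) := hA.trans (Finset.range_subset_range.2 (by omega))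
    have hA2 : insert i A ⊆ Finset.range (i + 1) := by
      rw [Finset.insert_subset_iff]
      exact ⟨by simp, hA1⟩
    have h1 := mem_searchList (n := n) hF d (i + 1) A (by omega) hA1
    have h2 := mem_searchList (n := n) hF d (i + 1) _ (by omega) hA2
    rw [searchList, hid]
    split_ifs with hf
    · refine List.Nodup.append (ih (i + 1) _ (by omega) hA1)
        (List.nodup_cons.2 ⟨fun h => ((h2 _).1 h).2.2.1 rfl, ih (i + 1) _ (by omega) hA2⟩) ?_
      intro B hB hB'
      have hiB : i ∉ B := fun h => hiA ((((h1 B).1 hB).2.2.2 i (by omega)).1 h)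
      rcases List.mem_cons.1 hB' with rfl | hB'
      · exact hiB (by simp)
      · exact hiB ((((h2 B).1 hB').2.2.2 i (by omega)).2 (by simp))
    · simpa using ih (i + 1) _ (by omega) hA1

namespace RAM

/-! ### The run of the program -/

/-- The enumeration program. -/
def enumProgram : Program := mainCmd.compile 0

/-- This is the shape, code before, loop, code after, in which the position-independent `Cmd.Runs`
applies to the loop. -/
theorem enumProgram_eq : enumProgram =
    initCmd.compile 0 ++ (Cmd.loop 2 bodyCmd).compile (initCmd.compile 0).length ++ [] := by
  simp [enumProgram, mainCmd, Cmd.compile, Cmd.length_compile]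

theorem length_enumProgram : enumProgram.length = initCmd.size + (bodyCmd.size + 2) := by
  rw [enumProgram, Cmd.length_compile]
  rfl

variable {x : List ℕ} {n : ℕ}

theorem exists_iterate_init (hx : x.getD 0 0 = n) : ∃ t s, t ≤ roundTime n ∧
    run enumProgram x t = s.at initCmd.size ∧ Ready n n ∅ s ∧ s.outs = [outWord x n ∅] := by
  obtain ⟨t, s, h1, h2, h3, h4⟩ := initCmd_reach hx
  refine ⟨t, s, h1, ?_, h3, h4⟩
  have := h2 [] ((Cmd.loop 2 bodyCmd).compile (initCmd.compile 0).length ++ [])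
  rw [List.nil_append, List.length_nil, ← List.append_assoc, ← enumProgram_eq, zero_add] at this
  exact this

theorem exists_iterate_round {i : ℕ} {A : Finset ℕ} {s : Cfg} (hs : Ready n (i + 1) A s) :
    ∃ t s', 1 ≤ t ∧ t ≤ roundTime n + 2 ∧
      (step enumProgram x)^[t] (s.at initCmd.size) = s'.at initCmd.size ∧
      RoundPost x n i A s s' := by
  obtain ⟨t, s', h1, h2, h3⟩ := bodyCmd_reach (x := x) hs
  refine ⟨t + 2, s', by omega, by omega, ?_, h3⟩
  have := h2.loop_body (a := 2) (by rw [hs.two]; omega) (initCmd.compile 0) []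
  rwa [← enumProgram_eq, Cmd.length_compile] at this

theorem step_of_ready_zero {A : Finset ℕ} {s : Cfg} (hs : Ready n 0 A s) :
    step enumProgram x (s.at initCmd.size) = s.at enumProgram.length := by
  have := Cmd.Runs.loop_zero (x := x) (c := bodyCmd) hs.two (initCmd.compile 0) []
  rwa [← enumProgram_eq, Cmd.length_compile, Cmd.size, ← length_enumProgram] at this

/-- When the pointer has come down from `n` to `i` with `A` unchanged, all extensions of `A` by
vertices from `i` on have been delivered. Each delivered set, and `A` itself, is charged at most `d`
rounds. -/
theorem exists_iterate_search (d : ℕ) : ∀ (i : ℕ) (A : Finset ℕ) (s : Cfg), i + d = n →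
    A ⊆ Finset.range i → Ready n n A s → ∃ t s',
      t ≤ (roundTime n + 2) * (((searchList (fun B => badCount x n B n = 0) n d A).length + 1) * d) ∧
      (step enumProgram x)^[t] (s.at initCmd.size) = s'.at initCmd.size ∧ Ready n i A s' ∧
      s'.outs = s.outs ++
        (searchList (fun B => badCount x n B n = 0) n d A).map (outWord x n) := by
  induction d with
  | zero =>
    intro i A s hi hA hs
    obtain rfl : i = n := by omega
    exact ⟨0, s, by simp, rfl, hs, by simp [searchList]⟩
  | succ d ih =>
    intro i A s hi hA hs
    have hid : n - (d + 1) = i := by omega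
    have hiA : i ∉ A := fun h => by simpa using hA h
    have hA1 : A ⊆ Finset.range (i + 1) := hA.trans (Finset.range_subset_range.2 (by omega))
    have hA2 : insert i A ⊆ Finset.range (i + 1) := by
      rw [Finset.insert_subset_iff]
      exact ⟨by simp, hA1⟩
    obtain ⟨t₁, s₁, ht₁, hrun₁, hs₁, ho₁⟩ := ih (i + 1) A s (by omega) hA1 hs
    obtain ⟨t₂, s₂, -, ht₂, hrun₂, hpost⟩ := exists_iterate_round (x := x) hs₁
    rw [RoundPost, if_neg hiA] at hpost
    rw [searchList, hid]
    split_ifs at hpost ⊢ with hb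
    · obtain ⟨hs₂, ho₂⟩ := hpost
      obtain ⟨t₃, s₃, ht₃, hrun₃, hs₃, ho₃⟩ := ih (i + 1) _ s₂ (by omega) hA2 hs₂
      -- Back at `i`, which is now a member, this round removes it and restores `A`.
      obtain ⟨t₄, s₄, -, ht₄, hrun₄, hpost⟩ := exists_iterate_round (x := x) hs₃
      rw [RoundPost, if_pos (by simp), Finset.erase_insert hiA] at hpost
      refine ⟨t₄ + (t₃ + (t₂ + t₁)), s₄, ?_, ?_, hpost.1, ?_⟩
      · rw [List.length_append, List.length_cons]
        generalize roundTime n + 2 = C at *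
        generalize List.length _ = e₁ at *
        generalize List.length _ = e₂ at *
        have h1 : C ≤ C * (e₁ + 1) := Nat.le_mul_of_pos_right _ (Nat.succ_pos _)
        have h2 : C ≤ C * (e₂ + 1) := Nat.le_mul_of_pos_right _ (Nat.succ_pos _)
        -- The last two summands pay for the round that adds `i` and the round that removes it.
        have : C * ((e₁ + (e₂ + 1) + 1) * (d + 1)) =
          C * ((e₁ + 1) * d) + C * ((e₂ + 1) * d) + C * (e₁ + 1) + C * (e₂ + 1) := by ring
        omega
      · rw [Function.iterate_add_apply, Function.iterate_add_apply, Function.iterate_add_apply,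
          hrun₁, hrun₂, hrun₃, hrun₄]
      · rw [hpost.2, ho₃, ho₂, ho₁]
        simp
    · refine ⟨t₂ + t₁, s₂, ?_, ?_, hpost.1, ?_⟩
      · rw [List.append_nil]
        generalize roundTime n + 2 = C at *
        generalize List.length _ = e₁ at *
        have h1 : C ≤ C * (e₁ + 1) := Nat.le_mul_of_pos_right _ (Nat.succ_pos _)
        have : C * ((e₁ + 1) * (d + 1)) = C * ((e₁ + 1) * d) + C * (e₁ + 1) := by ring
        omega
      · rw [Function.iterate_add_apply, hrun₁, hrun₂]
      · rw [hpost.2, ho₁, List.append_nil]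

theorem run_add (P : Program) (x : List ℕ) (t t' : ℕ) :
    run P x (t + t') = (step P x)^[t'] (run P x t) := by
  rw [add_comm, run, Function.iterate_add_apply]
  rfl

theorem exists_haltedBy (hx : x.getD 0 0 = n) : ∃ T,
    T ≤ (roundTime n + 2) *
      (((searchList (fun B => badCount x n B n = 0) n n ∅).length + 1) * (n + 1)) ∧
    HaltedBy enumProgram x T ∧ (run enumProgram x T).outs =
      (∅ :: searchList (fun B => badCount x n B n = 0) n n ∅).map (outWord x n) := by
  obtain ⟨t₁, s₁, ht₁, hrun₁, hs₁, ho₁⟩ := exists_iterate_init hx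
  obtain ⟨t₂, s₂, ht₂, hrun₂, hs₂, ho₂⟩ :=
    exists_iterate_search (x := x) n 0 ∅ s₁ (zero_add n) (by simp) hs₁
  have hrun : run enumProgram x (t₁ + t₂ + 1) = s₂.at enumProgram.length := by
    rw [run_add, run_add, hrun₁, hrun₂, Function.iterate_one, step_of_ready_zero hs₂]
  refine ⟨t₁ + t₂ + 1, ?_, ?_, ?_⟩
  · generalize List.length _ = e at *
    have h1 : roundTime n + 2 ≤ (roundTime n + 2) * (e + 1) :=
      Nat.le_mul_of_pos_right _ (Nat.succ_pos _)
    have : (roundTime n + 2) * ((e + 1) * (n + 1)) =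
      (roundTime n + 2) * ((e + 1) * n) + (roundTime n + 2) * (e + 1) := by ring
    omega
  · rw [HaltedBy, hrun, Cfg.at_pc]
  · rw [hrun, Cfg.at_outs, ho₂, ho₁]
    simp

/-! ### Delay and space -/

theorem step_of_halted {P : Program} {c : Cfg} (h : P.length ≤ c.pc) : step P x c = c := by
  rw [step, List.getElem?_eq_none h]

theorem iterate_step_of_halted {P : Program} {c : Cfg} (h : P.length ≤ c.pc) (t : ℕ) :
    (step P x)^[t] c = c :=
  Function.iterate_fixed (step_of_halted h) t

theorem HaltedBy.mono {P : Program} {t t' : ℕ} (h : HaltedBy P x t) (ht : t ≤ t') :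
    HaltedBy P x t' := by
  obtain ⟨k, rfl⟩ := Nat.exists_eq_add_of_le ht
  rw [HaltedBy, run_add, iterate_step_of_halted h]
  exact h

theorem length_outs_le_step (P : Program) (x : List ℕ) (c : Cfg) :
    c.outs.length ≤ (step P x c).outs.length := by
  unfold step
  split
  · next i _ => cases i <;> simp [Instr.exec, Cfg.write]
  · exact le_rfl

theorem length_outs_run_mono (P : Program) (x : List ℕ) :
    Monotone fun t => (run P x t).outs.length := by
  refine monotone_nat_of_le_succ fun t => ?_
  rw [run_add, Function.iterate_one]
  exact length_outs_le_step P x _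

/-- The configurations between two rounds, and the final ones. -/
def Checkpoint (n : ℕ) (c : Cfg) : Prop :=
  (∃ s i A, c = s.at initCmd.size ∧ Ready n i A s ∧ i ≤ n ∧ A ⊆ Finset.range n) ∨
    enumProgram.length ≤ c.pc ∧ MemBound (16 + n) (16 + n) c.mem

theorem Ready.memBound {i : ℕ} {A : Finset ℕ} {s : Cfg} (hs : Ready n i A s) (hi : i ≤ n)
    (hA : A ⊆ Finset.range n) : MemBound (16 + n) (16 + n) s.mem := by
  have hsize : ∀ k, k ≤ 16 + n → Nat.size k ≤ 16 + n := fun k hk =>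
    (Nat.size_le.2 Nat.lt_two_pow_self).trans hk
  have key : ∀ a, s.mem a ≠ 0 → a < 16 + n ∧ s.mem a ≤ 16 + n := by
    intro a ha
    rcases Nat.lt_or_ge a 16 with h16 | h16
    · refine ⟨by omega, ?_⟩
      rcases Nat.lt_or_ge a 3 with h3 | h3
      · have := hs.zero
        have := hs.one
        have := hs.two
        interval_cases a <;> omega
      · exact absurd (hs.clear a h3 h16) ha
    · obtain ⟨w, rfl⟩ := Nat.exists_eq_add_of_le h16
      rw [hs.arr, ind] at ha ⊢
      split_ifs at ha ⊢ with hw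
      · have := Finset.mem_range.1 (hA hw)
        omega
      · exact absurd rfl ha
  refine ⟨?_, fun a ha => ⟨hsize a (key a ha).1.le, hsize _ (key a ha).2⟩⟩
  have hsub : s.mem.support ⊆ Finset.range (16 + n) := fun a ha =>
    Finset.mem_range.2 (key a (Finsupp.mem_support_iff.1 ha)).1
  simpa using Finset.card_le_card hsub

theorem Checkpoint.memBound {c : Cfg} (hc : Checkpoint n c) :
    MemBound (16 + n) (16 + n) c.mem := by
  rcases hc with ⟨s, i, A, rfl, hs, hi, hA⟩ | ⟨-, h⟩
  · exact hs.memBound hi hA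
  · exact h

theorem RoundPost.exists_ready {i : ℕ} {A : Finset ℕ} {s s' : Cfg} (h : RoundPost x n i A s s')
    (hi : i + 1 ≤ n) (hA : A ⊆ Finset.range n) : ∃ j B, Ready n j B s' ∧ j ≤ n ∧
      B ⊆ Finset.range n ∧ (s.outs.length < s'.outs.length ∨ j = i) := by
  unfold RoundPost at h
  split_ifs at h
  · exact ⟨i, _, h.1, by omega, (Finset.erase_subset _ _).trans hA, Or.inr rfl⟩
  · refine ⟨n, _, h.1, le_rfl, ?_, Or.inl (by rw [h.2]; simp)⟩
    rw [Finset.insert_subset_iff]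
    exact ⟨by simpa using hi, hA⟩
  · exact ⟨i, _, h.1, by omega, hA, Or.inr rfl⟩

theorem Checkpoint.next {c : Cfg} (hc : Checkpoint n c) : ∃ w, 1 ≤ w ∧ w ≤ roundTime n + 2 ∧
    Checkpoint n ((step enumProgram x)^[w] c) := by
  rcases hc with ⟨s, i, A, rfl, hs, hi, hA⟩ | ⟨h, hm⟩
  · rcases i with _ | i
    · refine ⟨1, le_rfl, by omega, Or.inr ?_⟩
      rw [Function.iterate_one, step_of_ready_zero hs]
      exact ⟨le_rfl, hs.memBound hi hA⟩
    · obtain ⟨t, s', h1, h2, h3, h4⟩ := exists_iterate_round (x := x) hs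
      obtain ⟨j, B, h5, h6, h7, -⟩ := h4.exists_ready hi hA
      exact ⟨t, h1, h2, Or.inl ⟨s', j, B, h3, h5, h6, h7⟩⟩
  · refine ⟨1, le_rfl, by omega, Or.inr ?_⟩
    rw [iterate_step_of_halted h]
    exact ⟨h, hm⟩

/-- A round without delivery lowers the pointer by one, and pointer 0 leads to the halt. -/
theorem Ready.exists_progress (i : ℕ) : ∀ {A : Finset ℕ} {s : Cfg}, Ready n i A s → i ≤ n →
    A ⊆ Finset.range n → ∃ t ≤ i * (roundTime n + 2) + 1,
      s.outs.length < ((step enumProgram x)^[t] (s.at initCmd.size)).outs.length ∨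
      enumProgram.length ≤ ((step enumProgram x)^[t] (s.at initCmd.size)).pc := by
  induction i with
  | zero =>
    intro A s hs _ _
    refine ⟨1, by omega, Or.inr ?_⟩
    rw [Function.iterate_one, step_of_ready_zero hs, Cfg.at_pc]
  | succ i ih =>
    intro A s hs hi hA
    obtain ⟨t, s', h1, h2, h3, h4⟩ := exists_iterate_round (x := x) hs
    have hmul : (i + 1) * (roundTime n + 2) = i * (roundTime n + 2) + (roundTime n + 2) := by ring
    obtain ⟨j, B, h5, h6, h7, h8⟩ := h4.exists_ready hi hA
    rcases h8 with h8 | rfl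
    · exact ⟨t, by omega, Or.inl (by rwa [h3])⟩
    · obtain ⟨t', h9, h10⟩ := ih h5 h6 h7
      refine ⟨t' + t, by omega, ?_⟩
      rw [Function.iterate_add_apply, h3]
      refine h10.imp (lt_of_le_of_lt ?_) id
      have := h4
      unfold RoundPost at this
      split_ifs at this <;> simp [this.2]

theorem Checkpoint.exists_progress {c : Cfg} (hc : Checkpoint n c) :
    ∃ t ≤ n * (roundTime n + 2) + 1,
      c.outs.length < ((step enumProgram x)^[t] c).outs.length ∨
      enumProgram.length ≤ ((step enumProgram x)^[t] c).pc := by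
  rcases hc with ⟨s, i, A, rfl, hs, hi, hA⟩ | ⟨h, -⟩
  · obtain ⟨t, h1, h2⟩ := Ready.exists_progress (x := x) i hs hi hA
    refine ⟨t, h1.trans ?_, h2⟩
    gcongr
  · exact ⟨0, by omega, Or.inr h⟩

theorem exists_checkpoints (hx : x.getD 0 0 = n) (t : ℕ) :
    ∃ t₀ ≤ t, ∃ w ≤ roundTime n + 2, t < t₀ + w ∧
      (t₀ = 0 ∨ Checkpoint n (run enumProgram x t₀)) ∧
      Checkpoint n (run enumProgram x (t₀ + w)) := by
  have hinit : ∃ w, 1 ≤ w ∧ w ≤ roundTime n + 2 ∧ Checkpoint n (run enumProgram x w) := by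
    obtain ⟨w, s, h1, h2, h3, -⟩ := exists_iterate_init hx
    have hc : Checkpoint n (run enumProgram x w) :=
      Or.inl ⟨s, n, ∅, h2, h3, le_rfl, by simp⟩
    -- Only an upper bound for the initialization time is at hand; if it were 0, the start would
    -- already be a checkpoint and the next one is taken.
    rcases Nat.eq_zero_or_pos w with rfl | hw
    · obtain ⟨w', h4, h5, h6⟩ := hc.next (x := x)
      exact ⟨w', h4, h5, h6⟩
    · exact ⟨w, hw, by omega, hc⟩
  induction t with
  | zero =>
    obtain ⟨w, h1, h2, h3⟩ := hinit
    exact ⟨0, le_rfl, w, h2, by omega, Or.inl rfl, by rwa [zero_add]⟩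
  | succ t ih =>
    obtain ⟨t₀, h1, w, h2, h3, h4, h5⟩ := ih
    rcases Nat.lt_or_ge (t + 1) (t₀ + w) with h | h
    · exact ⟨t₀, by omega, w, h2, h, h4, h5⟩
    · obtain ⟨w', h6, h7, h8⟩ := h5.next (x := x)
      rw [← run_add] at h8
      exact ⟨t₀ + w, h, w', h7, by omega, Or.inr h5, h8⟩

theorem delayAtMost_enumProgram (hx : x.getD 0 0 = n) :
    DelayAtMost enumProgram x ((n + 2) * (roundTime n + 2)) := by
  intro t
  obtain ⟨t₀, h1, w, h2, h3, -, h4⟩ := exists_checkpoints hx t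
  obtain ⟨t', h5, h6⟩ := h4.exists_progress (x := x)
  rw [← run_add] at h6
  -- One round to the next checkpoint, `n` rounds to a delivery or pointer 0, and one step to the
  -- halt.
  have hmul : (n + 2) * (roundTime n + 2) = n * (roundTime n + 2) + 2 * (roundTime n + 2) := by ring
  have hle : t₀ + w + t' ≤ t + (n + 2) * (roundTime n + 2) := by omega
  rcases h6 with h6 | h6
  · left
    have h7 := length_outs_run_mono enumProgram x (show t ≤ t₀ + w by omega)
    have h8 := length_outs_run_mono enumProgram x hle
    exact lt_of_le_of_lt h7 (lt_of_lt_of_le h6 h8)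
  · right
    exact HaltedBy.mono h6 hle

theorem spaceAtMost_enumProgram {b : ℕ} (hb : ∀ i ∈ enumProgram, i.ConstLe b)
    (hx : x.getD 0 0 = n) (hsize : ∀ j, Nat.size (x.getD j 0) ≤ 16 + n) :
    SpaceAtMost enumProgram x
      ((16 + n + (roundTime n + 2)) * (2 * (16 + n + b + (roundTime n + 2)))) := by
  intro t
  obtain ⟨t₀, h1, w, h2, h3, h4, -⟩ := exists_checkpoints hx t
  -- `b` covers the constants of the program; at time 0 the memory is empty.
  have hm : MemBound (16 + n) (16 + n + b) (run enumProgram x t₀).mem := by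
    rcases h4 with rfl | h4
    · exact ⟨by simp [run], by simp [run]⟩
    · exact h4.memBound.mono le_rfl (Nat.le_add_right _ _)
  obtain ⟨u, rfl⟩ := Nat.exists_eq_add_of_le h1
  have h5 := hm.iterate_step (fun i hi => (hb i hi).mono (Nat.le_add_left _ _))
    (fun j => (hsize j).trans (Nat.le_add_right _ _)) u
  rw [← run_add] at h5
  exact (h5.mono (k' := 16 + n + (roundTime n + 2)) (b' := 16 + n + b + (roundTime n + 2))
    (by omega) (by omega)).memSize_le

/-! ### The meaning of the computed values -/

section Meaning

variable {G : SimpleGraph (Fin n)}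

theorem getD_encodeGraph_zero (G : SimpleGraph (Fin n)) : (encodeGraph G).getD 0 0 = n := rfl

open Classical in
theorem getD_encodeGraph (u v : Fin n) :
    (encodeGraph G).getD (1 + u * n + v) 0 = if G.Adj u v then 1 else 0 := by
  have hlt : (u : ℕ) * n + v < n * n :=
    calc (u : ℕ) * n + v < u * n + n := by omega
      _ = (u + 1) * n := by ring
      _ ≤ n * n := Nat.mul_le_mul_right _ u.2
  have hpos : 0 < n := v.pos
  rw [show 1 + (u : ℕ) * n + v = (u * n + v) + 1 by ring, encodeGraph, List.getD_cons_succ,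
    List.getD_eq_getElem _ _ (by simpa using hlt), List.getElem_ofFn]
  have hu : (⟨(u : ℕ) * n + v, hlt⟩ : Fin (n * n)).divNat = u := by
    ext
    simp only [Fin.coe_divNat]
    rw [mul_comm, Nat.mul_add_div hpos, Nat.div_eq_of_lt v.2, add_zero]
  have hv : (⟨(u : ℕ) * n + v, hlt⟩ : Fin (n * n)).modNat = v := by
    ext
    simp only [Fin.coe_modNat]
    rw [mul_comm, Nat.mul_add_mod, Nat.mod_eq_of_lt v.2]
  rw [hu, hv]

theorem size_getD_encodeGraph (j : ℕ) : Nat.size ((encodeGraph G).getD j 0) ≤ 16 + n := by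
  classical
  refine (Nat.size_le.2 Nat.lt_two_pow_self).trans ?_
  rcases j with _ | j
  · rw [getD_encodeGraph_zero]
    omega
  · rw [encodeGraph, List.getD_cons_succ]
    rcases Nat.lt_or_ge j (n * n) with h | h
    · rw [List.getD_eq_getElem _ _ (by simpa using h), List.getElem_ofFn]
      split_ifs <;> omega
    · rw [List.getD_eq_default _ _ (by simpa using h)]
      omega

theorem ind_eq_zero {A : Finset ℕ} {w : ℕ} : ind A w = 0 ↔ w ∉ A := by
  simp [ind]

open Classical in
theorem nbrCount_encodeGraph (A : Finset ℕ) (u : Fin n) :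
    nbrCount (encodeGraph G) A (1 + u * n) n =
      (Finset.univ.filter fun w : Fin n => (w : ℕ) ∈ A ∧ G.Adj u w).card := by
  rw [nbrCount, Finset.sum_range, Finset.card_filter]
  refine Finset.sum_congr rfl fun w _ => ?_
  rw [getD_encodeGraph, ind]
  by_cases h1 : (w : ℕ) ∈ A <;> by_cases h2 : G.Adj u w <;> simp [h1, h2]

theorem privCount_encodeGraph_ne_zero {A : Finset ℕ} {v : Fin n} (hv : (v : ℕ) ∈ A) :
    privCount (encodeGraph G) n A v n ≠ 0 ↔
      ∃ u : Fin n, (u : ℕ) ∉ A ∧ G.Adj v u ∧ ∀ w : Fin n, (w : ℕ) ∈ A → G.Adj w u → w = v := by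
  classical
  rw [privCount, Finset.sum_range, Ne, Finset.sum_eq_zero_iff]
  push Not
  simp only [Finset.mem_univ, true_and]
  refine exists_congr fun u => ?_
  rw [getD_encodeGraph, nbrCount_encodeGraph]
  have h1 : ∀ a b c : ℕ, 1 - (1 - a + b + (c - 1)) ≠ 0 ↔ a ≠ 0 ∧ b = 0 ∧ c ≤ 1 := by omega
  rw [h1, ind_eq_zero, G.adj_comm v u, Finset.card_le_one_iff]
  simp only [ne_eq, ite_eq_right_iff, one_ne_zero, imp_false, not_not, Finset.mem_filter,
    Finset.mem_univ, true_and]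
  constructor
  · rintro ⟨h2, h3, h4⟩
    -- `v` is itself a neighbour of `u` in `A`, so at most one such neighbour means none but `v`.
    exact ⟨h3, h2, fun w hw hwu => h4 ⟨hw, hwu.symm⟩ ⟨hv, h2⟩⟩
  · rintro ⟨h2, h3, h4⟩
    refine ⟨h3, h2, fun {w w'} hw hw' => ?_⟩
    rw [h4 w hw.1 hw.2.symm, h4 w' hw'.1 hw'.2.symm]

/-- The vertices whose numbers belong to `A`. -/
def vertexSet (n : ℕ) (A : Finset ℕ) : Set (Fin n) := {v | (v : ℕ) ∈ A}

theorem badCount_encodeGraph_eq_zero {A : Finset ℕ} :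
    badCount (encodeGraph G) n A n = 0 ↔ IsOpenIrredundant G (vertexSet n A) := by
  rw [badCount, Finset.sum_range, Finset.sum_eq_zero_iff]
  simp only [Finset.mem_univ, true_implies]
  refine forall_congr' fun v => ?_
  by_cases hv : (v : ℕ) ∈ A
  · have h1 := privCount_encodeGraph_ne_zero (G := G) hv
    have h2 : ∀ a : ℕ, 1 - a = 0 ↔ a ≠ 0 := by omega
    rw [ind, if_pos hv, h2, h1]
    exact ⟨fun h _ => h, fun h => h hv⟩
  · rw [ind, if_neg hv, Nat.zero_sub]
    exact iff_of_true rfl fun h => absurd h hv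

theorem outWord_encodeGraph (A : Finset ℕ) :
    outWord (encodeGraph G) n A = encodeFun (rdfOfSet G (vertexSet n A)) := by
  classical
  refine List.ext_getElem (by simp [outWord, encodeFun]) fun k h1 h2 => ?_
  have hk : k < n := by simpa [outWord] using h1
  simp only [outWord, encodeFun, List.getElem_map, List.getElem_range, List.getElem_ofFn]
  have hcount := nbrCount_encodeGraph (G := G) A ⟨k, hk⟩
  rw [Fin.val_mk] at hcount
  rw [outVal, hcount]
  by_cases hv : (⟨k, hk⟩ : Fin n) ∈ vertexSet n A
  · rw [rdfOfSet_eq_two_iff.2 hv, ind, if_pos (show k ∈ A from hv)]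
    simp
  · rw [ind, if_neg (show k ∉ A from hv), rdfOfSet, if_neg hv]
    split_ifs with h
    · obtain ⟨w, hw, hvw⟩ := h
      have : 0 < (Finset.univ.filter fun w : Fin n => (w : ℕ) ∈ A ∧ G.Adj ⟨k, hk⟩ w).card :=
        Finset.card_pos.2 ⟨w, by simpa using ⟨hw, hvw⟩⟩
      simp only [Fin.val_zero]
      omega
    · have : (Finset.univ.filter fun w : Fin n => (w : ℕ) ∈ A ∧ G.Adj ⟨k, hk⟩ w).card = 0 := by
        rw [Finset.card_eq_zero, Finset.filter_eq_empty_iff]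
        exact fun w _ hw => h ⟨w, hw.1, hw.2⟩
      rw [this]
      rfl

theorem encodeFun_injective : Function.Injective (encodeFun (n := n)) := by
  intro f g h
  have := List.ofFn_injective h
  funext i
  exact Fin.ext (congrFun this i)

end Meaning

end RAM

/-! ### The delivered words are the minimal Roman dominating functions -/

namespace RAM

variable {n : ℕ} {G : SimpleGraph (Fin n)}

theorem vertexSet_mono {A B : Finset ℕ} (h : A ⊆ B) : vertexSet n A ⊆ vertexSet n B :=
  fun _ hv => h hv

theorem vertexSet_inj {A B : Finset ℕ} (hA : A ⊆ Finset.range n) (hB : B ⊆ Finset.range n)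
    (h : vertexSet n A = vertexSet n B) : A = B := by
  have key : ∀ w (hw : w < n), w ∈ A ↔ w ∈ B := fun w hw => by
    have := congrArg (fun S : Set (Fin n) => (⟨w, hw⟩ : Fin n) ∈ S) h
    exact iff_of_eq this
  ext w
  by_cases hw : w < n
  · exact key w hw
  · exact iff_of_false (fun h => hw (Finset.mem_range.1 (hA h)))
      fun h => hw (Finset.mem_range.1 (hB h))

/-- The open irredundant sets in the order of the enumeration. -/
noncomputable def openIrredundantList (G : SimpleGraph (Fin n)) : List (Finset ℕ) :=
  ∅ :: searchList (fun B => badCount (encodeGraph G) n B n = 0) n n ∅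

theorem badCount_antitone (A B : Finset ℕ) (h : A ⊆ B)
    (hB : badCount (encodeGraph G) n B n = 0) : badCount (encodeGraph G) n A n = 0 :=
  badCount_encodeGraph_eq_zero.2 ((badCount_encodeGraph_eq_zero.1 hB).mono (vertexSet_mono h))

theorem mem_openIrredundantList {A : Finset ℕ} : A ∈ openIrredundantList G ↔
    IsOpenIrredundant G (vertexSet n A) ∧ A ⊆ Finset.range n := by
  rw [openIrredundantList, List.mem_cons,
    mem_searchList badCount_antitone n 0 ∅ (zero_add n) (by simp), badCount_encodeGraph_eq_zero]
  by_cases hA : A = ∅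
  · subst hA
    refine iff_of_true (Or.inl rfl) ⟨fun v hv => ?_, by simp⟩
    simp [vertexSet] at hv
  · simp [hA]

theorem nodup_map_openIrredundantList :
    ((openIrredundantList G).map (outWord (encodeGraph G) n)).Nodup := by
  refine List.Nodup.map_on ?_ (List.nodup_cons.2 ⟨fun h => ?_, ?_⟩)
  · intro A hA B hB h
    rw [outWord_encodeGraph, outWord_encodeGraph] at h
    refine vertexSet_inj (mem_openIrredundantList.1 hA).2 (mem_openIrredundantList.1 hB).2 ?_
    ext v
    rw [← rdfOfSet_eq_two_iff (G := G), encodeFun_injective h, rdfOfSet_eq_two_iff]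
  · rw [mem_searchList badCount_antitone n 0 ∅ (zero_add n) (by simp)] at h
    exact h.2.2.1 rfl
  · exact nodup_searchList badCount_antitone n 0 ∅ (zero_add n) (by simp)

theorem mem_map_openIrredundantList {w : List ℕ} :
    w ∈ (openIrredundantList G).map (outWord (encodeGraph G) n) ↔
      ∃ f, IsMinimalRdf G f ∧ encodeFun f = w := by
  classical
  rw [List.mem_map]
  constructor
  · rintro ⟨A, hA, rfl⟩
    exact ⟨_, isMinimalRdf_rdfOfSet (mem_openIrredundantList.1 hA).1, (outWord_encodeGraph A).symm⟩
  · rintro ⟨f, hf, rfl⟩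
    have hset : vertexSet n ((Finset.univ.filter fun v => f v = 2).map Fin.valEmbedding) =
        {v | f v = 2} := by
      ext v
      simp [vertexSet, ← Fin.ext_iff]
    refine ⟨(Finset.univ.filter fun v => f v = 2).map Fin.valEmbedding, ?_, ?_⟩
    · rw [mem_openIrredundantList, hset]
      refine ⟨hf.isOpenIrredundant, fun w hw => ?_⟩
      obtain ⟨v, -, rfl⟩ := Finset.mem_map.1 hw
      exact Finset.mem_range.2 v.2
    · rw [outWord_encodeGraph, hset, ← hf.eq_rdfOfSet]

/-- The delivered words are distinct encodings of minimal Roman dominating functions, so their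
number inherits the combinatorial bound. -/
theorem length_openIrredundantList_le (hG : IsIntervalGraph G) :
    ((openIrredundantList G).length : ℝ) ≤ √3 ^ n := by
  classical
  have h1 := hG.ncard_isMinimalRdf_le
  rw [Fintype.card_fin] at h1
  refine le_trans ?_ h1
  rw [Nat.cast_le, ← List.length_map (outWord (encodeGraph G) n),
    ← List.toFinset_card_of_nodup nodup_map_openIrredundantList, ← Set.ncard_coe_finset]
  have : (((openIrredundantList G).map (outWord (encodeGraph G) n)).toFinset : Set (List ℕ)) =
      encodeFun '' {f | IsMinimalRdf G f} := by
    ext w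
    rw [Finset.mem_coe, List.mem_toFinset, mem_map_openIrredundantList]
    rfl
  rw [this]
  exact Set.ncard_image_le (Set.toFinite _)

end RAM

theorem mainTheorem1 :
    -- one algorithm: total time `O*(√3 ^ n)`, polynomial delay, polynomial space
    (∃ (P : RAM.Program) (p d s : Polynomial ℕ),
      ∀ (n : ℕ) (G : SimpleGraph (Fin n)), IsIntervalGraph G →
        (∃ T : ℕ, (T : ℝ) ≤ ((p.eval n : ℕ) : ℝ) * Real.sqrt 3 ^ n ∧
          RAM.EnumeratesInTime P (encodeGraph G) {w | ∃ f, IsMinimalRdf G f ∧ encodeFun f = w} T) ∧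
        RAM.DelayAtMost P (encodeGraph G) (d.eval n) ∧
        RAM.SpaceAtMost P (encodeGraph G) (s.eval n)) ∧
    -- the number of minimal Roman dominating functions is `O*(√3 ^ n)`
    (∃ q : Polynomial ℕ, ∀ (V : Type) [Fintype V] (G : SimpleGraph V), IsIntervalGraph G →
      ({f | IsMinimalRdf G f}.ncard : ℝ) ≤ ((q.eval (Fintype.card V) : ℕ) : ℝ) *
        Real.sqrt 3 ^ Fintype.card V) ∧
    -- tightness: disjoint unions of paths `P₂` attain `√3 ^ n`
    (∀ k : ℕ, IsIntervalGraph (disjointUnionP2 k) ∧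
      ({f | IsMinimalRdf (disjointUnionP2 k) f}.ncard : ℝ) =
        Real.sqrt 3 ^ Fintype.card (Fin k × Fin 2)) := by
  refine ⟨?_, ⟨1, fun V _ G hG => ?_⟩, fun k => ⟨isIntervalGraph_disjointUnionP2 k, ?_⟩⟩
  · obtain ⟨b, hb⟩ := RAM.exists_constLe RAM.enumProgram
    obtain ⟨C, hC⟩ : ∃ C : Polynomial ℕ, ∀ n, C.eval n = RAM.roundTime n + 2 :=
      ⟨100 * (Polynomial.X + 1) ^ 3 + 2, fun n => by simp [RAM.roundTime]⟩
    refine ⟨RAM.enumProgram, C * (Polynomial.X + 1), (Polynomial.X + 2) * C,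
      (16 + Polynomial.X + C) * (2 * (16 + Polynomial.X + Polynomial.C b + C)),
      fun n G hG => ⟨?_, ?_, ?_⟩⟩
    · obtain ⟨T, hT, hhalt, houts⟩ := RAM.exists_haltedBy (RAM.getD_encodeGraph_zero G)
      refine ⟨T, ?_, hhalt, ?_, fun w => ?_⟩
      · have hT' : T ≤ (C * (Polynomial.X + 1)).eval n * (RAM.openIrredundantList G).length := by
          rw [Polynomial.eval_mul, hC]
          refine hT.trans (le_of_eq ?_)
          simp only [RAM.openIrredundantList, List.length_cons, Polynomial.eval_add,
            Polynomial.eval_X, Polynomial.eval_one]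
          ring
        refine (Nat.cast_le.2 hT').trans ?_
        rw [Nat.cast_mul]
        exact mul_le_mul_of_nonneg_left (RAM.length_openIrredundantList_le hG) (Nat.cast_nonneg _)
      · rw [houts]
        exact RAM.nodup_map_openIrredundantList
      · rw [houts]
        exact RAM.mem_map_openIrredundantList
    · have := RAM.delayAtMost_enumProgram (RAM.getD_encodeGraph_zero G)
      rw [Polynomial.eval_mul, hC]
      simpa using this
    · have := RAM.spaceAtMost_enumProgram hb (RAM.getD_encodeGraph_zero G)
        RAM.size_getD_encodeGraph
      simpa [hC] using this
  · simpa using hG.ncard_isMinimalRdf_le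
  · rw [ncard_isMinimalRdf_disjointUnionP2, Fintype.card_prod, Fintype.card_fin, Fintype.card_fin,
      mul_comm, pow_mul, Real.sq_sqrt (by norm_num)]
    norm_num
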